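/- **Setting.** Let $X$ be a connected, countable, simple graph of bounded degree with at least two vertices, and let $M\ge 1$ be the maximum of its degrees. A path of length $n\ge 1$ is a sequence of oriented edges $C=(e_1,\dots,e_n)$ in which $e_{i+1}$ starts at the end point of $e_i$; a vertex is a path of length $0$. We write $\ell(C)$ for the length of $C$, $\operatorname{end}(C)$ for its end point, and $\mathrm{bc}(C)=\#\{1\le i\le n-1 : e_i=\overline{e_{i+1}}\}$, where $\overline{e}$ is the inverse of $e$. For a vertex $x$ let $\mathcal B_x$ be the set of paths starting at $x$. On $\ell^2(VX)$ let $(A_Xf)(x)=\sum_{y\sim x}f(y)$, $(D_Xf)(x)=\deg(x)f(x)$, $\Delta_X=D_X-A_X$. For $t\in\mathbb C$ with $|t|<1$ put $I(t)=(1-t)I$, $Q_X(t)=D_X-I(t)$ and $$(C_m(t)f)(x)=\sum_{C\in\mathcal B_x,\ \ell(C)=m}t^{\mathrm{bc}(C)}f(\operatorname{end}(C))\qquad(m\ge 0),$$ all of which are bounded operators. For a bounded operator $B$ put $B(x_1,x_2)=(B\delta_{x_1})(x_2)$. Let $R_m(t)$ be the operator of multiplication by the bounded function $$R_m(t)(x)=\sum_{j=1}^{\lceil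 m/2\rceil-1}\sum_{i=1}^{j}(1-t)^{2(j-i)}(1-t^2)^{i-1}\Big(\deg(x)\,C_{m-2j}(t)(x,x)-\sum_{y\sim x}C_{m-2j}(t)(y,y)\Big).$$ Define $C_m^{\mathrm{cbc}}(t)=C_m(t)$ for $m=0,1$, $C_2^{\mathrm{cbc}}(t)=t\,C_2(t)$, and for $m\ge 3$ $$C_m^{\mathrm{cbc}}(t)=C_m(t)-\frac{Q_X(t)-I(t)}{1-t}\sum_{j=1}^{\lceil m/2\rceil-1}(1-t)^{2j}C_{m-2j}(t)+(1-t)R_m(t)-\delta_{2\mathbb Z}(m)(1-t)^{m-1}t\,D_X,$$ where $\delta_{2\mathbb Z}(m)$ is $1$ if $m$ is even and $0$ otherwise. The generalized Bartholdi zeta function is $$Z_X(u,t,x_0,x)=\exp\Big(\sum_{m=1}^\infty\frac{C_m^{\mathrm{cbc}}(t)(x_0,x)}{m}u^m\Big).$$ Finally let $\alpha(t)=\frac{1}{2}\big(M+\sqrt{M^2+4(|t|+1)M}\big)$ and $f(z)=zA_X-z^2(1-t)Q_X(t)$. For a bounded operator $T$ with $\|I-T\|<1$ let $\log T=-\sum_{n\ge1}\frac1n(I-T)^n$.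 **Theorem.** Let $t,u\in\mathbb C$ with $|t|<1$ and $|u|<1/\alpha(t)$, and let $x_0,x\in VX$. Then the series defining $Z_X(u,t,x_0,x)$ converges, $\|I-(I-u(D_X-\Delta_X)+(1-t)Q_X(t)u^2)\|<1$, the inner series over $n$ below converges for all $|z|<1/\alpha(t)$ and the integrand is holomorphic in that disc, the last series below converges, and $$\begin{aligned} Z_X(u,t,x_0,x)={}&\big(1-(1-t)^2u^2\big)^{-\frac{\deg(x_0)-2}{2}\delta_{x_0}(x)}\, \exp\Big(-\big[\log\big(I-u(D_X-\Delta_X)+(1-t)Q_X(t)u^2\big)\big](x_0,x)\Big)\\ &\times\exp\Big(\int_0^u(1-t)z^2\sum_{n=2}^\infty\frac1n\sum_{j=1}^{n-1}j\,\big[f(z)^{n-1-j}(A_XD_X-D_XA_X)f(z)^{j-1}\big](x_0,x)\,dz\Big)\\ &\times\exp\Big(\frac{[tD_X-C_2(t)](x_0,x)}{2}(1-t)u^2\Big)\, \exp\Big(\sum_{m=3}^\infty\frac{(1-t)R_m(t)(x_0,x)}{m}u^m\Big), \end{aligned}$$ where $\delta_{x_0}(x)$ is the Kronecker delta, the power is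 the principal one, and the integral is taken along the segment from $0$ to $u$. -/

import Mathlib

open Complex
open scoped BigOperators

namespace BartholdiZeta

/-! ### Bounded operators on `ℓ²` of the vertex set -/

/-- The Hilbert space `ℓ²(V)` of square summable complex functions on `V`. -/
abbrev L2 (V : Type*) : Type _ := lp (fun _ : V => ℂ) 2

/-- All absolute row sums and column sums of the kernel `k` are bounded by one constant. -/
def SchurBounded {V : Type*} (k : V → V → ℂ) : Prop :=
  ∃ B : ℝ, (∀ x, ∀ s : Finset V, ∑ y ∈ s, ‖k x y‖ ≤ B) ∧
    (∀ y, ∀ s : Finset V, ∑ x ∈ s, ‖k x y‖ ≤ B)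

theorem summable_norm_of_rows {V : Type*} {k : V → ℂ} {B : ℝ}
    (h : ∀ s : Finset V, ∑ y ∈ s, ‖k y‖ ≤ B) : Summable fun y => ‖k y‖ :=
  summable_of_sum_le (fun _ => norm_nonneg _) h

theorem summable_kernel_mul {V : Type*} {k : V → ℂ} {B : ℝ}
    (h : ∀ s : Finset V, ∑ y ∈ s, ‖k y‖ ≤ B) (f : L2 V) :
    Summable fun y => ‖k y‖ * ‖f y‖ := by
  refine Summable.of_nonneg_of_le (fun _ => by positivity) (fun y => ?_)
    ((summable_norm_of_rows h).mul_right ‖f‖)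
  exact mul_le_mul_of_nonneg_left (lp.norm_apply_le_norm (by norm_num) f y) (norm_nonneg _)

theorem sum_sq_le_norm_sq {V : Type*} (f : L2 V) (s : Finset V) :
    ∑ y ∈ s, ‖f y‖ ^ 2 ≤ ‖f‖ ^ 2 := by
  have := lp.sum_rpow_le_norm_rpow (p := 2) (by norm_num) f s
  simpa using this

/-- Schur test for one row. -/
theorem row_sq_le {V : Type*} {k : V → ℂ} {B : ℝ}
    (h : ∀ s : Finset V, ∑ y ∈ s, ‖k y‖ ≤ B) (f : L2 V) :
    Summable (fun y => ‖k y‖ * ‖f y‖ ^ 2) ∧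
      ‖∑' y, k y * f y‖ ^ 2 ≤ B * ∑' y, ‖k y‖ * ‖f y‖ ^ 2 := by
  have hB : 0 ≤ B := by simpa using h ∅
  have hs2 : Summable (fun y => ‖k y‖ * ‖f y‖ ^ 2) := by
    refine Summable.of_nonneg_of_le (fun _ => by positivity) (fun y => ?_)
      ((summable_norm_of_rows h).mul_right (‖f‖ ^ 2))
    have := lp.norm_apply_le_norm (by norm_num) f y
    gcongr
  refine ⟨hs2, ?_⟩
  have hs1 := summable_kernel_mul h f
  have h1 : ‖∑' y, k y * f y‖ ≤ ∑' y, ‖k y‖ * ‖f y‖ := by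
    have := norm_tsum_le_tsum_norm (f := fun y => k y * f y) (by simpa using hs1)
    simpa using this
  set S := ∑' y, ‖k y‖ * ‖f y‖ ^ 2 with hS
  have hS0 : 0 ≤ S := tsum_nonneg fun _ => by positivity
  have h2 : ∑' y, ‖k y‖ * ‖f y‖ ≤ Real.sqrt (B * S) := by
    refine hs1.tsum_le_of_sum_le fun s => ?_
    refine Real.le_sqrt_of_sq_le ?_
    have hcs := Finset.sum_mul_sq_le_sq_mul_sq s (fun y => Real.sqrt ‖k y‖)
      (fun y => Real.sqrt ‖k y‖ * ‖f y‖)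
    have e1 : ∀ y, Real.sqrt ‖k y‖ * (Real.sqrt ‖k y‖ * ‖f y‖) = ‖k y‖ * ‖f y‖ := fun y => by
      rw [← mul_assoc, Real.mul_self_sqrt (norm_nonneg _)]
    have e2 : ∀ y, Real.sqrt ‖k y‖ ^ 2 = ‖k y‖ := fun y => Real.sq_sqrt (norm_nonneg _)
    simp only [e1, mul_pow, e2] at hcs
    refine hcs.trans ?_
    have hle : ∑ y ∈ s, ‖k y‖ * ‖f y‖ ^ 2 ≤ S :=
      hs2.sum_le_tsum s fun _ _ => by positivity
    exact mul_le_mul (h s) hle (Finset.sum_nonneg fun _ _ => by positivity) hB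
  calc ‖∑' y, k y * f y‖ ^ 2 ≤ Real.sqrt (B * S) ^ 2 := by
        have := h1.trans h2
        gcongr
    _ = B * S := Real.sq_sqrt (by positivity)

/-- Schur test. -/
theorem schur_sq_le {V : Type*} {k : V → V → ℂ} {B : ℝ}
    (hr : ∀ x, ∀ s : Finset V, ∑ y ∈ s, ‖k x y‖ ≤ B)
    (hc : ∀ y, ∀ s : Finset V, ∑ x ∈ s, ‖k x y‖ ≤ B) (f : L2 V) (s : Finset V) :
    ∑ x ∈ s, ‖∑' y, k x y * f y‖ ^ 2 ≤ (|B| * ‖f‖) ^ 2 := by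
  rcases s.eq_empty_or_nonempty with rfl | ⟨x₀, hx₀⟩
  · simp only [Finset.sum_empty]; positivity
  have hB : 0 ≤ B := by simpa using hr x₀ ∅
  rw [abs_of_nonneg hB]
  calc ∑ x ∈ s, ‖∑' y, k x y * f y‖ ^ 2
      ≤ ∑ x ∈ s, B * ∑' y, ‖k x y‖ * ‖f y‖ ^ 2 :=
        Finset.sum_le_sum fun x _ => (row_sq_le (hr x) f).2
    _ = B * ∑' y, (∑ x ∈ s, ‖k x y‖) * ‖f y‖ ^ 2 := by
        rw [← Finset.mul_sum, ← Summable.tsum_finsetSum fun x _ => (row_sq_le (hr x) f).1]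
        simp only [Finset.sum_mul]
    _ ≤ B * (B * ‖f‖ ^ 2) := by
        refine mul_le_mul_of_nonneg_left ?_ hB
        have hsum : Summable fun y => (∑ x ∈ s, ‖k x y‖) * ‖f y‖ ^ 2 := by
          simp only [Finset.sum_mul]
          exact summable_sum fun x _ => (row_sq_le (hr x) f).1
        refine hsum.tsum_le_of_sum_le fun r => ?_
        calc ∑ y ∈ r, (∑ x ∈ s, ‖k x y‖) * ‖f y‖ ^ 2
            ≤ ∑ y ∈ r, B * ‖f y‖ ^ 2 :=
              Finset.sum_le_sum fun y _ =>
                mul_le_mul_of_nonneg_right (hc y s) (by positivity)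
          _ ≤ B * ‖f‖ ^ 2 := by
              rw [← Finset.mul_sum]
              exact mul_le_mul_of_nonneg_left (sum_sq_le_norm_sq f r) hB
    _ = (B * ‖f‖) ^ 2 := by ring

theorem kernel_memℓp {V : Type*} {k : V → V → ℂ} (h : SchurBounded k) (f : L2 V) :
    Memℓp (fun x => ∑' y, k x y * f y) 2 := by
  obtain ⟨B, hr, hc⟩ := h
  refine memℓp_gen' (C := (|B| * ‖f‖) ^ 2) fun s => ?_
  simpa using schur_sq_le hr hc f s

theorem summable_row {V : Type*} {k : V → V → ℂ} (h : SchurBounded k) (f : L2 V) (x : V) :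
    Summable fun y => k x y * f y := by
  obtain ⟨B, hr, _⟩ := h
  exact Summable.of_norm (by simpa using summable_kernel_mul (hr x) f)

/-- The bounded operator `(T f)(x) = ∑_y k(x, y) f(y)` on `ℓ²(V)`. -/
noncomputable def kernelOp {V : Type*} (k : V → V → ℂ) (h : SchurBounded k) :
    L2 V →L[ℂ] L2 V :=
  LinearMap.mkContinuousOfExistsBound
    { toFun := fun f => ⟨fun x => ∑' y, k x y * f y, kernel_memℓp h f⟩
      map_add' := fun f g => by
        apply lp.ext
        funext x
        change ∑' y, k x y * (f y + g y) = (∑' y, k x y * f y) + ∑' y, k x y * g y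
        rw [← (summable_row h f x).tsum_add (summable_row h g x)]
        simp only [mul_add]
      map_smul' := fun c f => by
        apply lp.ext
        funext x
        change ∑' y, k x y * (c * f y) = c * ∑' y, k x y * f y
        rw [← tsum_mul_left]
        exact tsum_congr fun y => by ring }
    (by
      obtain ⟨B, hr, hc⟩ := id h
      refine ⟨|B|, fun f => ?_⟩
      refine lp.norm_le_of_forall_sum_le (p := 2) (by norm_num) (by positivity) fun s => ?_
      simpa using schur_sq_le hr hc f s)

theorem kernelOp_apply {V : Type*} (k : V → V → ℂ) (h : SchurBounded k) (f : L2 V) (x : V) :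
    kernelOp k h f x = ∑' y, k x y * f y := rfl

theorem schurBounded_diag {V : Type*} [DecidableEq V] {d : V → ℂ} (h : ∃ B : ℝ, ∀ x, ‖d x‖ ≤ B) :
    SchurBounded fun x y => if x = y then d x else 0 := by
  obtain ⟨B, hB⟩ := h
  refine ⟨|B|, fun x s => ?_, fun y s => ?_⟩
  · simp only [apply_ite norm, norm_zero, Finset.sum_ite_eq]
    split_ifs
    exacts [(hB x).trans (le_abs_self B), abs_nonneg B]
  · simp only [apply_ite norm, norm_zero, Finset.sum_ite_eq']
    split_ifs
    exacts [(hB y).trans (le_abs_self B), abs_nonneg B]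

/-- The operator of multiplication by a bounded function `d`. -/
noncomputable def diagOp {V : Type*} [DecidableEq V] (d : V → ℂ) (h : ∃ B : ℝ, ∀ x, ‖d x‖ ≤ B) :
    L2 V →L[ℂ] L2 V :=
  kernelOp (fun x y => if x = y then d x else 0) (schurBounded_diag h)

theorem diagOp_apply {V : Type*} [DecidableEq V] (d : V → ℂ) (h : ∃ B : ℝ, ∀ x, ‖d x‖ ≤ B)
    (f : L2 V) (x : V) : diagOp d h f x = d x * f x := by
  rw [diagOp, kernelOp_apply, tsum_eq_single x fun y hy => by simp [hy.symm]]
  simp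

/-- `B(x₁, x₂) = (B δ_{x₁})(x₂)`. -/
noncomputable def entry {V : Type*} [DecidableEq V] (B : L2 V →L[ℂ] L2 V) (x₁ x₂ : V) : ℂ :=
  B (lp.single 2 x₁ (1 : ℂ)) x₂

theorem norm_entry_le {V : Type*} [DecidableEq V] (B : L2 V →L[ℂ] L2 V) (x₁ x₂ : V) :
    ‖entry B x₁ x₂‖ ≤ ‖B‖ := by
  refine (lp.norm_apply_le_norm (by norm_num) _ x₂).trans ((B.le_opNorm _).trans ?_)
  rw [lp.norm_single (by norm_num)]
  simp

/-- The logarithm of a bounded operator `T` near the identity,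
`log T = -∑_{n ≥ 1} (I - T)ⁿ / n`, the series being taken in operator norm. -/
noncomputable def opLog {V : Type*} (T : L2 V →L[ℂ] L2 V) : L2 V →L[ℂ] L2 V :=
  -∑' n : ℕ, ((n : ℂ) + 1)⁻¹ • (1 - T) ^ (n + 1)

/-- The integral `∫_0^u g(z) dz` along the straight segment from `0` to `u`. -/
noncomputable def segmentIntegral (g : ℂ → ℂ) (u : ℂ) : ℂ :=
  u * ∫ s in (0 : ℝ)..1, g ((s : ℂ) * u)

/-! ### Graphs of bounded degree -/

/-- The degrees of the vertices are bounded. -/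
def BoundedDegree {V : Type*} (G : SimpleGraph V) [G.LocallyFinite] : Prop :=
  ∃ M : ℕ, ∀ v, G.degree v ≤ M

/-- The maximum `M` of all degrees (a maximum whenever the degrees are bounded). -/
noncomputable def maxDeg {V : Type*} (G : SimpleGraph V) [G.LocallyFinite] : ℕ :=
  sSup (Set.range fun v => G.degree v)

/-- `α(t) = (M + √(M² + 4 (|t| + 1) M)) / 2`. -/
noncomputable def alpha {V : Type*} (G : SimpleGraph V) [G.LocallyFinite] (t : ℂ) : ℝ :=
  ((maxDeg G : ℝ) + Real.sqrt ((maxDeg G : ℝ) ^ 2 + 4 * (‖t‖ + 1) * (maxDeg G : ℝ))) / 2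

/-- The bump count of a path `(e₁, …, eₙ)`: the number of `i ∈ {1, …, n - 1}` such that `eᵢ` is
the inverse of `eᵢ₊₁`. -/
def bumpCount {V : Type*} [DecidableEq V] {G : SimpleGraph V} {x y : V} (C : G.Walk x y) : ℕ :=
  (C.darts.zip C.darts.tail).countP fun p => p.1 = p.2.symm

section Operators

variable {V : Type*} [DecidableEq V] (G : SimpleGraph V) [G.LocallyFinite]

theorem schurBounded_adj (hG : BoundedDegree G) :
    SchurBounded fun x y => if y ∈ G.neighborFinset x then (1 : ℂ) else 0 := by
  obtain ⟨M, hM⟩ := hG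
  have key : ∀ (x : V) (s : Finset V),
      ∑ y ∈ s, ‖(if y ∈ G.neighborFinset x then (1 : ℂ) else 0)‖ ≤ (M : ℝ) := by
    intro x s
    simp only [apply_ite norm, norm_zero, norm_one, Finset.sum_ite_mem, Finset.sum_const,
      nsmul_eq_mul, mul_one]
    exact_mod_cast (Finset.card_le_card Finset.inter_subset_right).trans (hM x)
  refine ⟨M, key, fun y s => ?_⟩
  refine le_trans (le_of_eq (Finset.sum_congr rfl fun x _ => ?_)) (key y s)
  have h : y ∈ G.neighborFinset x ↔ x ∈ G.neighborFinset y := by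
    simp only [SimpleGraph.mem_neighborFinset, G.adj_comm]
  simp only [h]

/-- The adjacency operator `(A f)(x) = ∑_{y ∼ x} f(y)`. -/
noncomputable def adjOp (hG : BoundedDegree G) : L2 V →L[ℂ] L2 V :=
  kernelOp (fun x y => if y ∈ G.neighborFinset x then 1 else 0) (schurBounded_adj G hG)

theorem adjOp_apply (hG : BoundedDegree G) (f : L2 V) (x : V) :
    adjOp G hG f x = ∑ y ∈ G.neighborFinset x, f y := by
  rw [adjOp, kernelOp_apply,
    tsum_eq_sum (s := G.neighborFinset x) fun y hy => by rw [if_neg hy, zero_mul]]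
  exact Finset.sum_congr rfl fun y hy => by rw [if_pos hy, one_mul]

theorem degree_bounded {V : Type*} (G : SimpleGraph V) [G.LocallyFinite] (hG : BoundedDegree G) : ∃ B : ℝ, ∀ x, ‖(G.degree x : ℂ)‖ ≤ B := by
  obtain ⟨M, hM⟩ := hG
  exact ⟨M, fun x => by simpa using hM x⟩

/-- The valency operator `(D f)(x) = deg(x) f(x)`. -/
noncomputable def valencyOp (hG : BoundedDegree G) : L2 V →L[ℂ] L2 V :=
  diagOp (fun x => (G.degree x : ℂ)) (degree_bounded G hG)

/-- The Laplacian `Δ = D - A`. -/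
noncomputable def laplacianOp (hG : BoundedDegree G) : L2 V →L[ℂ] L2 V :=
  valencyOp G hG - adjOp G hG

/-- `∑ t ^ bc(C)` over the paths `C` of length `m` from `x` to `y`. -/
def pathKernel (t : ℂ) (m : ℕ) (x y : V) : ℂ :=
  ∑ C ∈ G.finsetWalkLength m x y, t ^ bumpCount C

theorem bumpCount_le {V : Type*} [DecidableEq V] (G : SimpleGraph V) {x y : V} (C : G.Walk x y) :
    bumpCount C ≤ C.length := by
  refine List.countP_le_length.trans ?_
  simp

theorem norm_pathKernel_le (t : ℂ) (m : ℕ) (x y : V) :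
    ‖pathKernel G t m x y‖ ≤ (max 1 ‖t‖) ^ m * ((G.finsetWalkLength m x y).card : ℝ) := by
  refine (norm_sum_le _ _).trans ?_
  rw [mul_comm, ← nsmul_eq_mul]
  refine Finset.sum_le_card_nsmul _ _ _ fun C hC => ?_
  have hl := SimpleGraph.mem_finsetWalkLength_iff.1 hC
  rw [norm_pow]
  calc ‖t‖ ^ bumpCount C ≤ (max 1 ‖t‖) ^ bumpCount C := by
        gcongr
        exact le_max_right _ _
    _ ≤ (max 1 ‖t‖) ^ m := by
        refine pow_le_pow_right₀ (le_max_left _ _) ?_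
        rw [← hl]
        exact bumpCount_le G C

theorem sum_card_walks_le {M : ℕ} (hM : ∀ v, G.degree v ≤ M) (m : ℕ) (x : V) (s : Finset V) :
    ∑ y ∈ s, (G.finsetWalkLength m x y).card ≤ M ^ m := by
  induction m generalizing x with
  | zero =>
    have : ∀ y, (G.finsetWalkLength 0 x y).card = if x = y then 1 else 0 := by
      intro y
      by_cases h : x = y
      · subst h
        simp [SimpleGraph.finsetWalkLength]
      · simp [SimpleGraph.finsetWalkLength, h]
    simp only [this, Finset.sum_ite_eq, pow_zero]
    split_ifs <;> simp
  | succ n ih =>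
    have step : ∀ y, (G.finsetWalkLength (n + 1) x y).card ≤
        ∑ w : G.neighborSet x, (G.finsetWalkLength n w y).card := by
      intro y
      rw [SimpleGraph.finsetWalkLength]
      refine Finset.card_biUnion_le.trans (le_of_eq ?_)
      simp
    calc ∑ y ∈ s, (G.finsetWalkLength (n + 1) x y).card
        ≤ ∑ y ∈ s, ∑ w : G.neighborSet x, (G.finsetWalkLength n w y).card :=
          Finset.sum_le_sum fun y _ => step y
      _ = ∑ w : G.neighborSet x, ∑ y ∈ s, (G.finsetWalkLength n w y).card := Finset.sum_comm
      _ ≤ ∑ w : G.neighborSet x, M ^ n := Finset.sum_le_sum fun w _ => ih w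
      _ = G.degree x * M ^ n := by
          rw [Finset.sum_const, Finset.card_univ, SimpleGraph.card_neighborSet_eq_degree,
            smul_eq_mul]
      _ ≤ M * M ^ n := Nat.mul_le_mul_right _ (hM x)
      _ = M ^ (n + 1) := by ring

theorem card_walks_symm (m : ℕ) (x y : V) :
    (G.finsetWalkLength m x y).card = (G.finsetWalkLength m y x).card := by
  refine Finset.card_nbij' (fun C => C.reverse) (fun C => C.reverse) ?_ ?_ ?_ ?_
  · intro C hC
    simpa [SimpleGraph.mem_finsetWalkLength_iff] using hC
  · intro C hC
    simpa [SimpleGraph.mem_finsetWalkLength_iff] using hC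
  · intro C _
    simp
  · intro C _
    simp

theorem schurBounded_path (hG : BoundedDegree G) (t : ℂ) (m : ℕ) :
    SchurBounded (pathKernel G t m) := by
  obtain ⟨M, hM⟩ := hG
  have key : ∀ (x : V) (s : Finset V),
      (max 1 ‖t‖) ^ m * ∑ y ∈ s, ((G.finsetWalkLength m x y).card : ℝ) ≤
        (max 1 ‖t‖) ^ m * (M : ℝ) ^ m := by
    intro x s
    have := sum_card_walks_le G hM m x s
    gcongr
    exact_mod_cast this
  refine ⟨(max 1 ‖t‖) ^ m * (M : ℝ) ^ m, fun x s => ?_, fun y s => ?_⟩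
  · refine le_trans ?_ (key x s)
    rw [Finset.mul_sum]
    exact Finset.sum_le_sum fun y _ => norm_pathKernel_le G t m x y
  · refine le_trans ?_ (key y s)
    rw [Finset.mul_sum]
    refine Finset.sum_le_sum fun x _ => ?_
    rw [card_walks_symm G m y x]
    exact norm_pathKernel_le G t m x y

/-- The operator `(C_m(t) f)(x) = ∑ t ^ bc(C) f(t(C))`, the sum being over all paths `C` of
length `m` that start at `x`, `t(C)` denoting the end point of `C`; here the paths are grouped
by their end points. -/
noncomputable def pathOp (hG : BoundedDegree G) (t : ℂ) (m : ℕ) : L2 V →L[ℂ] L2 V :=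
  kernelOp (pathKernel G t m) (schurBounded_path G hG t m)

/-- `I(t) = (1 - t) I`. -/
noncomputable def idT (V : Type*) (t : ℂ) : L2 V →L[ℂ] L2 V :=
  (1 - t) • (1 : L2 V →L[ℂ] L2 V)

/-- `Q(t) = D - I(t)`. -/
noncomputable def QT (hG : BoundedDegree G) (t : ℂ) : L2 V →L[ℂ] L2 V :=
  valencyOp G hG - idT V t

/-- The Laplacian of the function `y ↦ C_m(t)(y, y)`, evaluated at `x`:
`deg(x) C_m(t)(x, x) - ∑_{y ∼ x} C_m(t)(y, y)`. -/
noncomputable def laplacianDiag (hG : BoundedDegree G) (t : ℂ) (m : ℕ) (x : V) : ℂ :=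
  (G.degree x : ℂ) * entry (pathOp G hG t m) x x -
    ∑ y ∈ G.neighborFinset x, entry (pathOp G hG t m) y y

/-- The function `R_m(t)(x) =
∑_{j=1}^{⌈m/2⌉-1} ∑_{i=1}^{j} (1-t)^{2(j-i)} (1-t²)^{i-1} [Δ C_{m-2j}(t)](x, x)`. -/
noncomputable def Rfun (hG : BoundedDegree G) (t : ℂ) (m : ℕ) (x : V) : ℂ :=
  ∑ j ∈ Finset.Icc 1 (⌈(m : ℚ) / 2⌉₊ - 1), ∑ i ∈ Finset.Icc 1 j,
    (1 - t) ^ (2 * (j - i)) * (1 - t ^ 2) ^ (i - 1) * laplacianDiag G hG t (m - 2 * j) x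

theorem laplacianDiag_bounded (hG : BoundedDegree G) (t : ℂ) (m : ℕ) :
    ∃ B : ℝ, ∀ x, ‖laplacianDiag G hG t m x‖ ≤ B := by
  obtain ⟨M, hM⟩ := id hG
  refine ⟨M * ‖pathOp G hG t m‖ + M * ‖pathOp G hG t m‖, fun x => ?_⟩
  have hx : (G.degree x : ℝ) ≤ M := by exact_mod_cast hM x
  refine (norm_sub_le _ _).trans (add_le_add ?_ ?_)
  · rw [norm_mul, Complex.norm_natCast]
    exact mul_le_mul hx (norm_entry_le _ _ _) (norm_nonneg _) (Nat.cast_nonneg _)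
  · refine (norm_sum_le _ _).trans ?_
    refine (Finset.sum_le_card_nsmul _ _ _ fun y _ => norm_entry_le _ y y).trans ?_
    rw [nsmul_eq_mul, SimpleGraph.card_neighborFinset_eq_degree]
    exact mul_le_mul_of_nonneg_right hx (norm_nonneg _)

theorem Rfun_bounded (hG : BoundedDegree G) (t : ℂ) (m : ℕ) :
    ∃ B : ℝ, ∀ x, ‖Rfun G hG t m x‖ ≤ B := by
  choose B hB using laplacianDiag_bounded G hG t
  refine ⟨∑ j ∈ Finset.Icc 1 (⌈(m : ℚ) / 2⌉₊ - 1), ∑ i ∈ Finset.Icc 1 j,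
    ‖(1 - t) ^ (2 * (j - i)) * (1 - t ^ 2) ^ (i - 1)‖ * B (m - 2 * j), fun x => ?_⟩
  refine norm_sum_le_of_le _ fun j _ => norm_sum_le_of_le _ fun i _ => ?_
  rw [norm_mul]
  exact mul_le_mul_of_nonneg_left (hB _ x) (norm_nonneg _)

/-- The operator `(R_m(t) f)(x) = R_m(t)(x) f(x)`. -/
noncomputable def Rop (hG : BoundedDegree G) (t : ℂ) (m : ℕ) : L2 V →L[ℂ] L2 V :=
  diagOp (Rfun G hG t m) (Rfun_bounded G hG t m)

/-- The operators `C_m^{cbc}(t)`. -/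
noncomputable def cbcOp (hG : BoundedDegree G) (t : ℂ) (m : ℕ) : L2 V →L[ℂ] L2 V :=
  if m ≤ 1 then pathOp G hG t m
  else if m = 2 then t • pathOp G hG t 2
  else
    pathOp G hG t m
      - ((1 - t)⁻¹ • (QT G hG t - idT V t)) *
          ∑ j ∈ Finset.Icc 1 (⌈(m : ℚ) / 2⌉₊ - 1), (1 - t) ^ (2 * j) • pathOp G hG t (m - 2 * j)
      + (1 - t) • Rop G hG t m
      - (if Even m then (1 - t) ^ (m - 1) * t else 0) • valencyOp G hG

/-- The generalized Bartholdi zeta function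
`Z(u, t, x₀, x) = exp (∑_{m ≥ 1} C_m^{cbc}(t)(x₀, x) uᵐ / m)`. -/
noncomputable def zeta (hG : BoundedDegree G) (u t : ℂ) (x₀ x : V) : ℂ :=
  exp (∑' m : ℕ, entry (cbcOp G hG t (m + 1)) x₀ x / ((m : ℂ) + 1) * u ^ (m + 1))

/-- `f(z) = z A - z² (1 - t) Q(t)`. -/
noncomputable def fOp (hG : BoundedDegree G) (t z : ℂ) : L2 V →L[ℂ] L2 V :=
  z • adjOp G hG - (z ^ 2 * (1 - t)) • QT G hG t

/-- The term `(1/n) ∑_{j=1}^{n-1} j [f(z)^{n-1-j} (A D - D A) f(z)^{j-1}](x₀, x)`. -/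
noncomputable def commTerm (hG : BoundedDegree G) (t z : ℂ) (x₀ x : V) (n : ℕ) : ℂ :=
  1 / (n : ℂ) * ∑ j ∈ Finset.Icc 1 (n - 1), (j : ℂ) *
    entry (fOp G hG t z ^ (n - 1 - j) *
      (adjOp G hG * valencyOp G hG - valencyOp G hG * adjOp G hG) *
      fOp G hG t z ^ (j - 1)) x₀ x

/-- The integrand `(1 - t) z² ∑_{n ≥ 2} (1/n) ∑_{j=1}^{n-1} j [⋯](x₀, x)`. -/
noncomputable def commIntegrand (hG : BoundedDegree G) (t : ℂ) (x₀ x : V) (z : ℂ) : ℂ :=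
  (1 - t) * z ^ 2 * ∑' n : ℕ, commTerm G hG t z x₀ x (n + 2)

end Operators

end BartholdiZeta

namespace BartholdiZeta

/-! ### Recursions for path counts weighted by bumps -/

section PathRecursion

set_option linter.unusedSectionVars false

variable {V : Type*} [DecidableEq V] (G : SimpleGraph V) [G.LocallyFinite]

/-! Splitting off the first edge of a path gives C_m = A C_{m-1} - (1-t) Q C_{m-2} for m ≥ 3, while
for m = 2 the valency operator D = Q + (1-t)I stands in place of Q (`pathOp_add_three`,
`pathOp_two`). The generating function P = ∑_{m≥1} z^m C_m therefore satisfies (I - f(z))(I + P) =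
(1 - (1-t)²z²) I; the scalar on the right is exactly the defect at m = 2
(`one_sub_fOp_mul_tsum_pathOp`).

The operator C_m^{cbc} is a main part `mainOp` plus (1-t)R_m for m ≥ 3, and plus (1-t)(tD - C_2) for
m = 2; these two corrections pass unchanged into the last two exponentials. The geometric sums of
C_{m-2j} in the main part obey a two-step recursion, so the generating function of the main part can
be computed from P (`hasSum_mainOp`): it is z f'(z)(I - f(z))⁻¹ plus (1-t)²z²/(1-(1-t)²z²) times D -
2I. Dividing by z gives the derivative of the main part of log Z. The scalar fraction integrates to
a logarithm and yields the power in front.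

If f and f' commuted, f'(I - f)⁻¹ would be the derivative of -log(I - f). In general that derivative
is ∑_n (1/n) ∑_i f^{n-1-i} f' f^i, and moving f' to the left costs commutators [f', f] = (1-t)z²(AD
- DA) (`nsmul_mul_pow_sub_sum`, `fOpDeriv_commutator`). Their sum is the integrand of the theorem
(`hasDerivAt_logSeries`), and integration along the segment gives `mainSeries_eq`.

Convergence rests on α(t) being the positive root of a² = Ma + (1+|t|)M: this equation gives ‖C_m‖ ≤
α^m from the recursion, and ‖f(z)‖ < 1 for |z| < 1/α. -/

theorem adj_of_neighborSet {x : V} (w : G.neighborSet x) : G.Adj x w := w.2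

theorem sum_finsetWalkLength_succ {E : Type*} [AddCommMonoid E] (n : ℕ) (x y : V)
    (g : G.Walk x y → E) :
    ∑ C ∈ G.finsetWalkLength (n + 1) x y, g C =
      ∑ w : G.neighborSet x, ∑ C ∈ G.finsetWalkLength n w y,
        g (SimpleGraph.Walk.cons (adj_of_neighborSet G w) C) := by
  rw [SimpleGraph.finsetWalkLength, Finset.sum_biUnion]
  · exact Finset.sum_congr rfl fun w _ => Finset.sum_map _ _ _
  · intro v _ w _ hvw
    rw [Function.onFun, Finset.disjoint_left]
    intro C hC hC'
    obtain ⟨C₁, _, rfl⟩ := Finset.mem_map.1 hC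
    obtain ⟨C₂, _, h⟩ := Finset.mem_map.1 hC'
    exact hvw (Subtype.ext (SimpleGraph.Walk.cons.inj h).1.symm)

theorem bumpCount_cons_nil {x y : V} (h : G.Adj x y) :
    bumpCount (SimpleGraph.Walk.cons h SimpleGraph.Walk.nil) = 0 := by
  simp [bumpCount]

theorem bumpCount_cons_cons {x w v y : V} (h : G.Adj x w) (h' : G.Adj w v) (C : G.Walk v y) :
    bumpCount (SimpleGraph.Walk.cons h (SimpleGraph.Walk.cons h' C)) =
      bumpCount (SimpleGraph.Walk.cons h' C) + if x = v then 1 else 0 := by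
  simp [bumpCount, List.countP_cons, SimpleGraph.Dart.ext_iff]

theorem pathKernel_zero (t : ℂ) (x y : V) :
    pathKernel G t 0 x y = if x = y then 1 else 0 := by
  unfold pathKernel
  by_cases h : x = y
  · subst h
    simp [SimpleGraph.finsetWalkLength, bumpCount]
  · simp [SimpleGraph.finsetWalkLength, h]

theorem sum_finsetWalkLength_zero {E : Type*} [AddCommMonoid E] (x y : V) (g : G.Walk x y → E) :
    ∑ C ∈ G.finsetWalkLength 0 x y, g C =
      if h : x = y then g (SimpleGraph.Walk.nil.copy rfl h) else 0 := by
  by_cases h : x = y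
  · subst h
    simp [SimpleGraph.finsetWalkLength]
  · simp [SimpleGraph.finsetWalkLength, h]

theorem pathKernel_one (t : ℂ) (x y : V) :
    pathKernel G t 1 x y = ∑ w : G.neighborSet x, pathKernel G t 0 w y := by
  rw [pathKernel, sum_finsetWalkLength_succ]
  refine Finset.sum_congr rfl fun w _ => ?_
  have hw := adj_of_neighborSet G w
  obtain ⟨w, _⟩ := w
  rw [pathKernel_zero, sum_finsetWalkLength_zero]
  by_cases h : w = y
  · subst h
    simp [bumpCount_cons_nil G hw]
  · simp [h]

/-- Removing the first edge of a path: only the paths that return to `x` after one step acquire a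
bump at that edge. -/
theorem pathKernel_add_two (t : ℂ) (n : ℕ) (x y : V) :
    pathKernel G t (n + 2) x y = ∑ w : G.neighborSet x, pathKernel G t (n + 1) w y -
      (1 - t) * ∑ w : G.neighborSet x, ∑ C ∈ G.finsetWalkLength n x y,
        t ^ bumpCount (SimpleGraph.Walk.cons (adj_of_neighborSet G w).symm C) := by
  rw [pathKernel, sum_finsetWalkLength_succ, Finset.mul_sum, ← Finset.sum_sub_distrib]
  refine Finset.sum_congr rfl fun w _ => ?_
  rw [pathKernel, sum_finsetWalkLength_succ, sum_finsetWalkLength_succ]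
  -- The bump at the new edge is present exactly when v = x; writing its weight as t = 1 - (1-t)
  -- leaves a correction concentrated at that single v.
  have hx : ∀ v : G.neighborSet w.1, ∑ C ∈ G.finsetWalkLength n v y,
      t ^ bumpCount (SimpleGraph.Walk.cons (adj_of_neighborSet G w) (SimpleGraph.Walk.cons (adj_of_neighborSet G v) C)) =
      ∑ C ∈ G.finsetWalkLength n v y, t ^ bumpCount (SimpleGraph.Walk.cons (adj_of_neighborSet G v) C) -
      if v = ⟨x, (adj_of_neighborSet G w).symm⟩ then (1 - t) * ∑ C ∈ G.finsetWalkLength n v y,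
        t ^ bumpCount (SimpleGraph.Walk.cons (adj_of_neighborSet G v) C) else 0 := by
    intro v
    simp only [bumpCount_cons_cons, pow_add, ← Finset.sum_mul]
    by_cases h : x = v
    · rw [if_pos h, if_pos (Subtype.ext h.symm)]
      ring
    · rw [if_neg h, if_neg fun h' => h (congrArg Subtype.val h').symm]
      ring
  simp only [hx, Finset.sum_sub_distrib, Finset.sum_ite_eq', Finset.mem_univ, if_true]

/-- After an immediate return to x the remaining path is trivial, so no second bump can occur and
every neighbour contributes with weight 1. This is why the full degree appears here. -/
theorem pathKernel_two (t : ℂ) (x y : V) :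
    pathKernel G t 2 x y = ∑ w : G.neighborSet x, pathKernel G t 1 w y -
      (1 - t) * ((G.degree x : ℂ) * pathKernel G t 0 x y) := by
  rw [pathKernel_add_two]
  congr 2
  simp only [sum_finsetWalkLength_zero, pathKernel_zero]
  by_cases h : x = y
  · subst h
    simp [bumpCount_cons_nil, ← SimpleGraph.card_neighborSet_eq_degree]
  · simp [h]

/-- The remaining path now begins with an edge from x to some v, and the return edge from w to x
bumps with it exactly when w = v. Summing t^[w = v] over the neighbours w of x gives deg(x) - (1-t),
the diagonal entry of Q. -/
theorem pathKernel_add_three (t : ℂ) (n : ℕ) (x y : V) :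
    pathKernel G t (n + 3) x y = ∑ w : G.neighborSet x, pathKernel G t (n + 2) w y -
      (1 - t) * (((G.degree x : ℂ) - (1 - t)) * pathKernel G t (n + 1) x y) := by
  rw [pathKernel_add_two]
  congr 2
  simp only [pathKernel, sum_finsetWalkLength_succ, bumpCount_cons_cons, pow_add,
    ← Finset.sum_mul]
  rw [Finset.sum_comm, Finset.mul_sum]
  refine Finset.sum_congr rfl fun v _ => ?_
  rw [← Finset.mul_sum, mul_comm]
  congr 1
  have h1 : ∀ w : G.neighborSet x, t ^ (if (w : V) = v then 1 else 0) =
      1 - if w = v then (1 - t) else 0 := by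
    intro w
    by_cases h : w = v
    · simp [h]
    · rw [if_neg h, if_neg fun h' => h (Subtype.ext h')]
      simp
  simp [h1, Finset.sum_sub_distrib, ← SimpleGraph.card_neighborSet_eq_degree]

theorem adjOp_mul_pathOp_apply (hG : BoundedDegree G) (t : ℂ) (m : ℕ) (f : L2 V) (x : V) :
    (adjOp G hG * pathOp G hG t m) f x =
      ∑' y, (∑ w : G.neighborSet x, pathKernel G t m w y) * f y := by
  change adjOp G hG (pathOp G hG t m f) x = _
  rw [adjOp_apply]
  simp only [Finset.sum_mul]
  rw [Summable.tsum_finsetSum fun (w : G.neighborSet x) _ =>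
    summable_row (schurBounded_path G hG t m) f w]
  exact (Finset.sum_subtype _ (fun w => G.mem_neighborFinset x w)
    fun w => pathOp G hG t m f w)

theorem summable_adj_pathKernel (hG : BoundedDegree G) (t : ℂ) (m : ℕ) (f : L2 V) (x : V) :
    Summable fun y => (∑ w : G.neighborSet x, pathKernel G t m w y) * f y := by
  simp only [Finset.sum_mul]
  exact summable_sum fun w _ => summable_row (schurBounded_path G hG t m) f w

theorem pathOp_zero (hG : BoundedDegree G) (t : ℂ) : pathOp G hG t 0 = 1 := by
  ext f x
  simp only [pathOp, kernelOp_apply, pathKernel_zero]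
  rw [tsum_eq_single x fun y hy => by simp [hy.symm]]
  simp

theorem pathOp_one (hG : BoundedDegree G) (t : ℂ) : pathOp G hG t 1 = adjOp G hG := by
  have h := fun f x => adjOp_mul_pathOp_apply G hG t 0 f x
  simp only [pathOp_zero, mul_one] at h
  ext f x
  rw [h, pathOp, kernelOp_apply]
  simp only [pathKernel_one]

theorem valencyOp_apply (hG : BoundedDegree G) (f : L2 V) (x : V) :
    valencyOp G hG f x = (G.degree x : ℂ) * f x :=
  diagOp_apply _ _ _ _

theorem QT_apply (hG : BoundedDegree G) (t : ℂ) (f : L2 V) (x : V) :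
    QT G hG t f x = ((G.degree x : ℂ) - (1 - t)) * f x := by
  change valencyOp G hG f x - (1 - t) * f x = _
  rw [valencyOp_apply]
  ring

theorem pathOp_two (hG : BoundedDegree G) (t : ℂ) :
    pathOp G hG t 2 = adjOp G hG * adjOp G hG - (1 - t) • valencyOp G hG := by
  have hA : adjOp G hG * adjOp G hG = adjOp G hG * pathOp G hG t 1 := by rw [pathOp_one]
  rw [hA]
  ext f x
  change _ = (adjOp G hG * pathOp G hG t 1) f x - (1 - t) * valencyOp G hG f x
  -- Reading f(x) as C_0 f(x) turns every term into a sum against a path kernel, so that the kernel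
  -- recursion can be applied termwise.
  have h0 : f x = pathOp G hG t 0 f x := by rw [pathOp_zero]; rfl
  rw [adjOp_mul_pathOp_apply, valencyOp_apply, h0, pathOp, pathOp, kernelOp_apply, kernelOp_apply,
    ← tsum_mul_left, ← tsum_mul_left, ← Summable.tsum_sub (summable_adj_pathKernel G hG t 1 f x)
      (((summable_row (schurBounded_path G hG t 0) f x).mul_left _).mul_left _)]
  refine tsum_congr fun y => ?_
  rw [pathKernel_two]
  ring

theorem pathOp_add_three (hG : BoundedDegree G) (t : ℂ) (n : ℕ) :
    pathOp G hG t (n + 3) = adjOp G hG * pathOp G hG t (n + 2) -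
      (1 - t) • (QT G hG t * pathOp G hG t (n + 1)) := by
  ext f x
  change _ = (adjOp G hG * pathOp G hG t (n + 2)) f x -
    (1 - t) * QT G hG t (pathOp G hG t (n + 1) f) x
  rw [adjOp_mul_pathOp_apply, QT_apply, pathOp, pathOp, kernelOp_apply, kernelOp_apply,
    ← tsum_mul_left, ← tsum_mul_left,
    ← Summable.tsum_sub (summable_adj_pathKernel G hG t (n + 2) f x)
      (((summable_row (schurBounded_path G hG t (n + 1)) f x).mul_left _).mul_left _)]
  refine tsum_congr fun y => ?_
  rw [pathKernel_add_three]
  ring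

end PathRecursion

end BartholdiZeta

namespace BartholdiZeta

/-! ### Degrees and the constant α -/

section Degrees

variable {V : Type*} (G : SimpleGraph V) [G.LocallyFinite]

theorem one_le_degree [Nontrivial V] (hconn : G.Connected) (v : V) : 1 ≤ G.degree v :=
  hconn.preconnected.degree_pos_of_nontrivial v

theorem degree_le_maxDeg (hG : BoundedDegree G) (v : V) : G.degree v ≤ maxDeg G := by
  obtain ⟨M, hM⟩ := hG
  exact le_csSup ⟨M, by rintro _ ⟨w, rfl⟩; exact hM w⟩ ⟨v, rfl⟩

theorem one_le_maxDeg [Nontrivial V] (hconn : G.Connected) (hG : BoundedDegree G) :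
    1 ≤ maxDeg G :=
  (one_le_degree G hconn hconn.nonempty.some).trans (degree_le_maxDeg G hG _)

theorem alpha_sq (t : ℂ) :
    alpha G t ^ 2 = maxDeg G * alpha G t + (1 + ‖t‖) * maxDeg G := by
  have h : Real.sqrt ((maxDeg G : ℝ) ^ 2 + 4 * (‖t‖ + 1) * (maxDeg G : ℝ)) ^ 2 =
      (maxDeg G : ℝ) ^ 2 + 4 * (‖t‖ + 1) * (maxDeg G : ℝ) := Real.sq_sqrt (by positivity)
  unfold alpha
  linear_combination h / 4

theorem maxDeg_le_alpha (t : ℂ) : (maxDeg G : ℝ) ≤ alpha G t := by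
  have h : (maxDeg G : ℝ) ≤
      Real.sqrt ((maxDeg G : ℝ) ^ 2 + 4 * (‖t‖ + 1) * (maxDeg G : ℝ)) :=
    Real.le_sqrt_of_sq_le (le_add_of_nonneg_right (by positivity))
  unfold alpha
  linarith

variable {G} in
theorem one_le_alpha (hM : 1 ≤ maxDeg G) (t : ℂ) : 1 ≤ alpha G t :=
  le_trans (by exact_mod_cast hM) (maxDeg_le_alpha G t)

variable {G} in
-- If α ≤ 1 + |t|, then α² = Mα + (1+|t|)M ≥ α + (1+|t|) ≥ 2α, whence α ≥ 2 > 1 + |t|.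
theorem one_add_norm_lt_alpha (hM : 1 ≤ maxDeg G) {t : ℂ} (ht : ‖t‖ < 1) :
    1 + ‖t‖ < alpha G t := by
  have h1 := alpha_sq G t
  have h2 := one_le_alpha hM t
  have hM' : (1 : ℝ) ≤ maxDeg G := by exact_mod_cast hM
  by_contra! h
  have h3 : alpha G t + (1 + ‖t‖) ≤ alpha G t ^ 2 := by
    rw [h1]
    have := norm_nonneg t
    nlinarith
  nlinarith [norm_nonneg t]

variable {G} in
theorem norm_one_sub_lt_alpha (hM : 1 ≤ maxDeg G) {t : ℂ} (ht : ‖t‖ < 1) :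
    ‖1 - t‖ < alpha G t :=
  lt_of_le_of_lt (by simpa using norm_sub_le 1 t) (one_add_norm_lt_alpha hM ht)

variable {G} in
theorem norm_one_sub_sq_le_alpha_sq (hM : 1 ≤ maxDeg G) {t : ℂ} (ht : ‖t‖ < 1) :
    ‖1 - t ^ 2‖ ≤ alpha G t ^ 2 := by
  have h1 := one_add_norm_lt_alpha hM ht
  have h2 := one_le_alpha hM t
  have h3 : ‖1 - t ^ 2‖ ≤ 1 + ‖t‖ ^ 2 := by
    rw [← norm_pow]
    simpa only [norm_one] using norm_sub_le 1 (t ^ 2)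
  nlinarith [norm_nonneg t]

/-- The left side is the majorant of ‖f(z)‖ on |z| = r; it increases with r and equals 1 at r = 1/α
by the quadratic equation for α. -/
theorem majorant_lt_one (hM : 1 ≤ maxDeg G) (t : ℂ) {r : ℝ} (hr0 : 0 ≤ r)
    (hr : r < 1 / alpha G t) : r * maxDeg G + r ^ 2 * ((1 + ‖t‖) * maxDeg G) < 1 := by
  have ha : 0 < alpha G t := lt_of_lt_of_le one_pos (one_le_alpha hM t)
  have hra : r * alpha G t < 1 := by rwa [lt_div_iff₀ ha] at hr
  have hM' : (1 : ℝ) ≤ maxDeg G := by exact_mod_cast hM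
  have h1 : 1 / alpha G t * maxDeg G + (1 / alpha G t) ^ 2 * ((1 + ‖t‖) * maxDeg G) = 1 := by
    have := alpha_sq G t
    field_simp
    linarith
  calc r * maxDeg G + r ^ 2 * ((1 + ‖t‖) * maxDeg G)
      < 1 / alpha G t * maxDeg G + (1 / alpha G t) ^ 2 * ((1 + ‖t‖) * maxDeg G) := by
        refine add_lt_add_of_lt_of_le (mul_lt_mul_of_pos_right hr (by linarith)) ?_
        gcongr
    _ = 1 := h1

end Degrees

/-! ### Operator norms and matrix entries -/

section Norms

theorem norm_kernelOp_le {V : Type*} (k : V → V → ℂ) (h : SchurBounded k) {B : ℝ} (hB : 0 ≤ B)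
    (hr : ∀ x, ∀ s : Finset V, ∑ y ∈ s, ‖k x y‖ ≤ B)
    (hc : ∀ y, ∀ s : Finset V, ∑ x ∈ s, ‖k x y‖ ≤ B) : ‖kernelOp k h‖ ≤ B := by
  refine ContinuousLinearMap.opNorm_le_bound _ hB fun f => ?_
  refine lp.norm_le_of_forall_sum_le (p := 2) (by norm_num) (by positivity) fun s => ?_
  have := schur_sq_le hr hc f s
  rw [abs_of_nonneg hB] at this
  simpa [kernelOp_apply] using this

variable {V : Type*} [DecidableEq V]

theorem norm_diagOp_le (d : V → ℂ) (h : ∃ B : ℝ, ∀ x, ‖d x‖ ≤ B) {B : ℝ} (hB : 0 ≤ B)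
    (hd : ∀ x, ‖d x‖ ≤ B) : ‖diagOp d h‖ ≤ B := by
  refine norm_kernelOp_le _ _ hB (fun x s => ?_) (fun y s => ?_)
  · simp only [apply_ite norm, norm_zero, Finset.sum_ite_eq]
    split_ifs
    exacts [hd x, hB]
  · simp only [apply_ite norm, norm_zero, Finset.sum_ite_eq']
    split_ifs
    exacts [hd y, hB]

theorem entry_diagOp (d : V → ℂ) (h : ∃ B : ℝ, ∀ x, ‖d x‖ ≤ B) (x₀ x : V) :
    entry (diagOp d h) x₀ x = if x₀ = x then d x₀ else 0 := by
  rw [entry, diagOp_apply]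
  by_cases hx : x₀ = x
  · subst hx
    simp
  · simp [hx, Ne.symm hx]

/-- `B ↦ B(x₁, x₂)` as a bounded linear functional. -/
noncomputable def entryCLM (x₁ x₂ : V) : (L2 V →L[ℂ] L2 V) →L[ℂ] ℂ :=
  LinearMap.mkContinuous
    { toFun := fun B => entry B x₁ x₂
      map_add' := fun _ _ => rfl
      map_smul' := fun _ _ => rfl } 1 fun B => by
      rw [one_mul]
      exact norm_entry_le B x₁ x₂

theorem entryCLM_apply (B : L2 V →L[ℂ] L2 V) (x₁ x₂ : V) : entryCLM x₁ x₂ B = entry B x₁ x₂ := rfl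

variable (G : SimpleGraph V) [G.LocallyFinite]

theorem norm_adjOp_le (hG : BoundedDegree G) : ‖adjOp G hG‖ ≤ maxDeg G := by
  have key : ∀ (x : V) (s : Finset V),
      ∑ y ∈ s, ‖(if y ∈ G.neighborFinset x then (1 : ℂ) else 0)‖ ≤ (maxDeg G : ℝ) := by
    intro x s
    simp only [apply_ite norm, norm_zero, norm_one, Finset.sum_ite_mem, Finset.sum_const,
      nsmul_eq_mul, mul_one]
    exact_mod_cast (Finset.card_le_card Finset.inter_subset_right).trans (degree_le_maxDeg G hG x)
  refine norm_kernelOp_le _ _ (by positivity) key fun y s => ?_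
  refine le_trans (le_of_eq (Finset.sum_congr rfl fun x _ => ?_)) (key y s)
  have h : y ∈ G.neighborFinset x ↔ x ∈ G.neighborFinset y := by
    simp only [SimpleGraph.mem_neighborFinset, G.adj_comm]
  simp only [h]

theorem QT_eq_diagOp (hG : BoundedDegree G) (t : ℂ)
    (h : ∃ B : ℝ, ∀ x, ‖(G.degree x : ℂ) - (1 - t)‖ ≤ B) :
    QT G hG t = diagOp (fun x => (G.degree x : ℂ) - (1 - t)) h := by
  ext f x
  rw [QT_apply, diagOp_apply]

/-- As deg(x) ≥ 1, the diagonal entry is the nonnegative integer deg(x) - 1 plus t, of norm at most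
M - 1 + |t|. Without isolated vertices excluded, the bound M could fail. -/
theorem norm_QT_le (hG : BoundedDegree G) (hdeg : ∀ v, 1 ≤ G.degree v) {t : ℂ} (ht : ‖t‖ < 1) :
    ‖QT G hG t‖ ≤ maxDeg G := by
  have key : ∀ x, ‖(G.degree x : ℂ) - (1 - t)‖ ≤ maxDeg G := by
    intro x
    have h1 : (G.degree x : ℂ) - (1 - t) = ((G.degree x - 1 : ℕ) : ℂ) + t := by
      push_cast [hdeg x]
      ring
    have h2 : ((G.degree x - 1 : ℕ) : ℝ) + 1 ≤ maxDeg G := by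
      have := degree_le_maxDeg G hG x
      have := hdeg x
      exact_mod_cast (by omega : G.degree x - 1 + 1 ≤ maxDeg G)
    rw [h1]
    refine (norm_add_le _ _).trans ?_
    rw [Complex.norm_natCast]
    linarith
  rw [QT_eq_diagOp G hG t ⟨_, key⟩]
  exact norm_diagOp_le _ _ (by positivity) key

theorem norm_fOp_le (hG : BoundedDegree G) (hdeg : ∀ v, 1 ≤ G.degree v) {t : ℂ} (ht : ‖t‖ < 1)
    (z : ℂ) : ‖fOp G hG t z‖ ≤ ‖z‖ * maxDeg G + ‖z‖ ^ 2 * ((1 + ‖t‖) * maxDeg G) := by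
  refine (norm_sub_le _ _).trans ?_
  rw [norm_smul, norm_smul, norm_mul, norm_pow]
  have h1 := norm_adjOp_le G hG
  have h2 := norm_QT_le G hG hdeg ht
  have h3 : ‖1 - t‖ ≤ 1 + ‖t‖ := by simpa using norm_sub_le 1 t
  rw [mul_assoc (‖z‖ ^ 2)]
  gcongr

/-- The recursion gives ‖C_m‖ ≤ Mα^{m-1} + (1+|t|)Mα^{m-2} = α^m, the last step being the quadratic
equation for α. For m = 2 the bound M² ≤ αM is used as well. -/
theorem norm_pathOp_le (hG : BoundedDegree G) (hdeg : ∀ v, 1 ≤ G.degree v) {t : ℂ}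
    (ht : ‖t‖ < 1) (m : ℕ) : ‖pathOp G hG t m‖ ≤ alpha G t ^ m := by
  have hA := norm_adjOp_le G hG
  have hQ := norm_QT_le G hG hdeg ht
  have hMa := maxDeg_le_alpha G t
  have ha := alpha_sq G t
  have h3 : ‖1 - t‖ ≤ 1 + ‖t‖ := by simpa using norm_sub_le 1 t
  have ha0 : 0 ≤ alpha G t := le_trans (by positivity) hMa
  have hD : ‖valencyOp G hG‖ ≤ maxDeg G := norm_diagOp_le _ _ (by positivity) fun x => by
    simpa using degree_le_maxDeg G hG x
  induction m using Nat.strong_induction_on with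
  | _ m ih =>
    match m with
    | 0 =>
      rw [pathOp_zero, pow_zero]
      exact ContinuousLinearMap.norm_id_le
    | 1 =>
      rw [pathOp_one, pow_one]
      exact hA.trans hMa
    | 2 =>
      rw [pathOp_two]
      refine (norm_sub_le _ _).trans ?_
      rw [norm_smul, ha]
      refine add_le_add ((norm_mul_le _ _).trans ?_) ?_ <;> gcongr
      exact hA.trans hMa
    | n + 3 =>
      rw [pathOp_add_three]
      refine (norm_sub_le _ _).trans ?_
      rw [norm_smul]
      have h1 := ih (n + 2) (by omega)
      have h2 := ih (n + 1) (by omega)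
      calc ‖adjOp G hG * pathOp G hG t (n + 2)‖ +
            ‖1 - t‖ * ‖QT G hG t * pathOp G hG t (n + 1)‖
          ≤ maxDeg G * alpha G t ^ (n + 2) +
            (1 + ‖t‖) * (maxDeg G * alpha G t ^ (n + 1)) := by
            refine add_le_add ((norm_mul_le _ _).trans ?_)
              (mul_le_mul h3 ((norm_mul_le _ _).trans ?_) (norm_nonneg _) (by positivity)) <;>
            gcongr
        _ = (maxDeg G * alpha G t + (1 + ‖t‖) * maxDeg G) * alpha G t ^ (n + 1) := by ring
        _ = alpha G t ^ (n + 3) := by rw [← ha]; ring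

end Norms

end BartholdiZeta

namespace BartholdiZeta

/-! ### Generating function of the main part -/

section MainOperators

/-- The coefficient of the valency operator in `C_{n+1}^{cbc}(t)`. -/
noncomputable def evenCoeff (t : ℂ) (n : ℕ) : ℂ :=
  if Even (n + 1) then (1 - t) ^ n * t else 0

theorem evenCoeff_zero (t : ℂ) : evenCoeff t 0 = 0 := by simp [evenCoeff]

theorem evenCoeff_one (t : ℂ) : evenCoeff t 1 = (1 - t) * t := by simp [evenCoeff]

theorem evenCoeff_add_two (t : ℂ) (n : ℕ) :
    evenCoeff t (n + 2) = (1 - t) ^ 2 * evenCoeff t n := by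
  simp only [evenCoeff, show n + 2 + 1 = n + 1 + 2 by ring, Nat.even_add, even_two, iff_true]
  split_ifs <;> ring

theorem norm_evenCoeff_le {t : ℂ} (ht : ‖t‖ < 1) {a : ℝ} (ha1 : 1 ≤ a) (ha : ‖1 - t‖ ≤ a)
    (n : ℕ) : ‖evenCoeff t n‖ ≤ a ^ (n + 1) := by
  unfold evenCoeff
  split_ifs
  · rw [norm_mul, norm_pow, pow_succ]
    exact mul_le_mul (pow_le_pow_left₀ (norm_nonneg _) ha _) (by linarith) (norm_nonneg _)
      (by positivity)
  · rw [norm_zero]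
    positivity

theorem summable_smul_of_norm_le {E : Type*} [NormedAddCommGroup E] [NormedSpace ℂ E]
    [CompleteSpace E] {c : ℕ → E} {K a : ℝ} (ha0 : 0 ≤ a)
    (hc : ∀ n : ℕ, ‖c n‖ ≤ K * ((n + 1) * a ^ (n + 1))) {z : ℂ} (hz : ‖z‖ * a < 1) :
    Summable fun n : ℕ => z ^ (n + 1) • c n := by
  have h0 : 0 ≤ ‖z‖ * a := by positivity
  have h1 : Summable fun n : ℕ => (n : ℝ) ^ 1 * (‖z‖ * a) ^ n :=
    summable_pow_mul_geometric_of_norm_lt_one 1 (by rwa [Real.norm_of_nonneg h0])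
  have hs : Summable fun n : ℕ => K * (((n : ℝ) + 1) * (‖z‖ * a) ^ (n + 1)) := by
    have h2 := ((summable_nat_add_iff 1).2 h1).mul_left K
    simpa only [pow_one, Nat.cast_add, Nat.cast_one] using h2
  refine Summable.of_norm_bounded hs fun n => ?_
  rw [norm_smul, norm_pow, mul_pow]
  have h3 := mul_le_mul_of_nonneg_left (hc n) (pow_nonneg (norm_nonneg z) (n + 1))
  linarith

theorem hasSum_evenCoeff {t : ℂ} (ht : ‖t‖ < 1) {a : ℝ} (ha1 : 1 ≤ a) (ha : ‖1 - t‖ ≤ a)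
    {z : ℂ} (hz : ‖z‖ * a < 1) (hw : 1 - (1 - t) ^ 2 * z ^ 2 ≠ 0) :
    HasSum (fun n : ℕ => z ^ (n + 1) * evenCoeff t n)
      ((1 - t) * t * z ^ 2 / (1 - (1 - t) ^ 2 * z ^ 2)) := by
  have ha0 : 0 ≤ a := zero_le_one.trans ha1
  have hs : Summable fun n : ℕ => z ^ (n + 1) • evenCoeff t n := by
    refine summable_smul_of_norm_le (K := 1) ha0 (fun n => ?_) hz
    rw [one_mul]
    exact (norm_evenCoeff_le ht ha1 ha n).trans
      (le_mul_of_one_le_left (by positivity) (by simp))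
  simp only [smul_eq_mul] at hs
  -- Two terms are split off: the sum S then satisfies S = (1-t)t z² + (1-t)²z² S.
  have e1 := hs.tsum_eq_zero_add
  have e2 := ((summable_nat_add_iff 1).2 hs).tsum_eq_zero_add
  have e3 : ∑' n : ℕ, z ^ (n + 1 + 1 + 1) * evenCoeff t (n + 1 + 1) =
      ((1 - t) ^ 2 * z ^ 2) * ∑' n : ℕ, z ^ (n + 1) * evenCoeff t n := by
    rw [← tsum_mul_left]
    refine tsum_congr fun n => ?_
    rw [evenCoeff_add_two]
    ring
  simp only [zero_add, evenCoeff_zero, evenCoeff_one, mul_zero] at e1 e2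
  convert hs.hasSum using 1
  rw [div_eq_iff hw]
  linear_combination (-1 : ℂ) * e1 - e2 - e3

variable {V : Type*} [DecidableEq V] (G : SimpleGraph V) [G.LocallyFinite]

/-- The sum `∑_{1 ≤ j ≤ n / 2} (1 - t)^{2j} C_{n+1-2j}(t)`. -/
noncomputable def geomPathSum (hG : BoundedDegree G) (t : ℂ) (n : ℕ) : L2 V →L[ℂ] L2 V :=
  ∑ j ∈ Finset.Icc 1 (n / 2), (1 - t) ^ (2 * j) • pathOp G hG t (n + 1 - 2 * j)

theorem geomPathSum_zero (hG : BoundedDegree G) (t : ℂ) : geomPathSum G hG t 0 = 0 := by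
  simp [geomPathSum]

theorem geomPathSum_one (hG : BoundedDegree G) (t : ℂ) : geomPathSum G hG t 1 = 0 := by
  simp [geomPathSum]

theorem geomPathSum_eq_range (hG : BoundedDegree G) (t : ℂ) (n : ℕ) :
    geomPathSum G hG t n = ∑ j ∈ Finset.range (n / 2),
      (1 - t) ^ (2 * (1 + j)) • pathOp G hG t (n + 1 - 2 * (1 + j)) := by
  rw [geomPathSum, ← Finset.Ico_add_one_right_eq_Icc, Finset.sum_Ico_eq_sum_range,
    Nat.add_sub_cancel]

/-- The summand j = 1 produces C_{n+1}; the others are those of `geomPathSum` at n with j raised by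
one. -/
theorem geomPathSum_add_two (hG : BoundedDegree G) (t : ℂ) (n : ℕ) :
    geomPathSum G hG t (n + 2) =
      (1 - t) ^ 2 • (pathOp G hG t (n + 1) + geomPathSum G hG t n) := by
  rw [geomPathSum_eq_range, geomPathSum_eq_range, show (n + 2) / 2 = n / 2 + 1 by omega,
    Finset.sum_range_succ', add_comm, smul_add, Finset.smul_sum]
  congr 1
  refine Finset.sum_congr rfl fun j _ => ?_
  rw [smul_smul, ← pow_add, show n + 2 + 1 - 2 * (1 + (j + 1)) = n + 1 - 2 * (1 + j) by omega,
    show 2 * (1 + (j + 1)) = 2 + 2 * (1 + j) by ring]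

theorem norm_geomPathSum_le (hG : BoundedDegree G) (hdeg : ∀ v, 1 ≤ G.degree v)
    (hM : 1 ≤ maxDeg G) {t : ℂ} (ht : ‖t‖ < 1) (n : ℕ) :
    ‖geomPathSum G hG t n‖ ≤ n * alpha G t ^ (n + 1) := by
  have ha := (norm_one_sub_lt_alpha hM ht).le
  have ha0 : 0 ≤ alpha G t := (norm_nonneg _).trans ha
  induction n using Nat.twoStepInduction with
  | zero => simp [geomPathSum_zero]
  | one => simpa [geomPathSum_one] using pow_nonneg ha0 2
  | more n ih _ =>
    rw [geomPathSum_add_two, norm_smul, norm_pow]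
    have h := norm_pathOp_le G hG hdeg ht (n + 1)
    calc ‖1 - t‖ ^ 2 * ‖pathOp G hG t (n + 1) + geomPathSum G hG t n‖
        ≤ alpha G t ^ 2 * (alpha G t ^ (n + 1) + n * alpha G t ^ (n + 1)) := by
          gcongr
          exact (norm_add_le _ _).trans (add_le_add h ih)
      _ = (n + 1 : ℝ) * alpha G t ^ (n + 2 + 1) := by ring
      _ ≤ ((n + 2 : ℕ) : ℝ) * alpha G t ^ (n + 2 + 1) := by
          push_cast
          gcongr
          norm_num

/-- The part of `C_{n+1}^{cbc}(t)` that neither involves `R_{n+1}(t)` nor the exceptional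
convention for paths of length two. -/
noncomputable def mainOp (hG : BoundedDegree G) (t : ℂ) (n : ℕ) : L2 V →L[ℂ] L2 V :=
  pathOp G hG t (n + 1) - ((1 - t)⁻¹ • (QT G hG t - idT V t)) * geomPathSum G hG t n
    - evenCoeff t n • valencyOp G hG

theorem exists_norm_mainOp_le (hG : BoundedDegree G) (hdeg : ∀ v, 1 ≤ G.degree v)
    (hM : 1 ≤ maxDeg G) {t : ℂ} (ht : ‖t‖ < 1) :
    ∃ K : ℝ, 0 ≤ K ∧ ∀ n, ‖mainOp G hG t n‖ ≤ K * ((n + 1) * alpha G t ^ (n + 1)) := by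
  refine ⟨1 + ‖(1 - t)⁻¹ • (QT G hG t - idT V t)‖ + ‖valencyOp G hG‖, by positivity, fun n => ?_⟩
  have ha := (norm_one_sub_lt_alpha hM ht).le
  have ha0 : 0 ≤ alpha G t := (norm_nonneg _).trans ha
  have hp : 0 ≤ alpha G t ^ (n + 1) := by positivity
  have h1 := norm_pathOp_le G hG hdeg ht (n + 1)
  have h2 := norm_geomPathSum_le G hG hdeg hM ht n
  have h3 := norm_evenCoeff_le ht (one_le_alpha hM t) ha n
  have h4 : alpha G t ^ (n + 1) ≤ (n + 1) * alpha G t ^ (n + 1) :=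
    le_mul_of_one_le_left hp (by simp)
  rw [add_mul, add_mul, one_mul]
  refine (norm_sub_le _ _).trans (add_le_add ((norm_sub_le _ _).trans
    (add_le_add (h1.trans h4) ((norm_mul_le _ _).trans ?_))) ?_)
  · refine mul_le_mul_of_nonneg_left (h2.trans ?_) (norm_nonneg _)
    gcongr
    simp
  · rw [norm_smul, mul_comm]
    exact mul_le_mul_of_nonneg_left (h3.trans h4) (norm_nonneg _)

section Sums

variable (hG : BoundedDegree G) (hdeg : ∀ v, 1 ≤ G.degree v) (hM : 1 ≤ maxDeg G) {t : ℂ}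
  (ht : ‖t‖ < 1) {z : ℂ} (hz : ‖z‖ * alpha G t < 1)

include hdeg hM ht hz

theorem summable_pathOp : Summable fun n : ℕ => z ^ (n + 1) • pathOp G hG t (n + 1) := by
  have ha0 : 0 ≤ alpha G t := zero_le_one.trans (one_le_alpha hM t)
  refine summable_smul_of_norm_le (K := 1) ha0 (fun n => ?_) hz
  rw [one_mul]
  exact (norm_pathOp_le G hG hdeg ht _).trans (le_mul_of_one_le_left (by positivity) (by simp))

theorem summable_geomPathSum : Summable fun n : ℕ => z ^ (n + 1) • geomPathSum G hG t n := by
  have ha0 : 0 ≤ alpha G t := zero_le_one.trans (one_le_alpha hM t)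
  refine summable_smul_of_norm_le (K := 1) ha0 (fun n => ?_) hz
  rw [one_mul]
  refine (norm_geomPathSum_le G hG hdeg hM ht n).trans ?_
  gcongr
  simp

/-- By the recursion all coefficients of z^m with m ≥ 3 cancel, and so does that of z. At z² there
remains -(1-t)D + (1-t)Q = -(1-t)²I. -/
theorem one_sub_fOp_mul_tsum_pathOp :
    (1 - fOp G hG t z) * (1 + ∑' n : ℕ, z ^ (n + 1) • pathOp G hG t (n + 1)) =
      (1 - (1 - t) ^ 2 * z ^ 2) • (1 : L2 V →L[ℂ] L2 V) := by
  have hs1 := summable_pathOp G hG hdeg hM ht hz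
  have hs2 := (summable_nat_add_iff 1).2 hs1
  have e1 := hs1.tsum_eq_zero_add
  have e2 := hs2.tsum_eq_zero_add
  have e3 : ∑' n : ℕ, z ^ (n + 1 + 1 + 1) • pathOp G hG t (n + 1 + 1 + 1) =
      (z • adjOp G hG) * (∑' n : ℕ, z ^ (n + 1 + 1) • pathOp G hG t (n + 1 + 1)) -
      ((z ^ 2 * (1 - t)) • QT G hG t) * ∑' n : ℕ, z ^ (n + 1) • pathOp G hG t (n + 1) := by
    rw [← hs1.tsum_mul_left, ← hs2.tsum_mul_left, ← (hs2.mul_left _).tsum_sub (hs1.mul_left _)]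
    refine tsum_congr fun n => ?_
    rw [pathOp_add_three]
    simp only [smul_mul_assoc, mul_smul_comm, smul_sub, smul_smul]
    (congr 2; ring)
  simp only [zero_add, pow_one, pathOp_one, pathOp_two, Nat.reduceAdd] at e1 e2
  rw [e3] at e2
  have hD : valencyOp G hG = QT G hG t + (1 - t) • (1 : L2 V →L[ℂ] L2 V) := by
    rw [QT, idT, sub_add_cancel]
  rw [hD] at e2
  generalize ∑' n : ℕ, z ^ (n + 1) • pathOp G hG t (n + 1) = P₁ at *
  generalize ∑' n : ℕ, z ^ (n + 1 + 1) • pathOp G hG t (n + 1 + 1) = P₂ at *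
  have e4 : (1 - fOp G hG t z) * (1 + P₁) = 1 + P₁ - z • adjOp G hG -
      (z • adjOp G hG) * P₁ + ((z ^ 2 * (1 - t)) • QT G hG t) * (1 + P₁) := by
    rw [fOp]
    noncomm_ring
  -- Only behind zA is P₁ expanded: this releases z²A², which cancels the A² of C_2, while the
  -- product of Q with P₁ stays intact and cancels as a whole.
  have e5 : (z • adjOp G hG) * P₁ = (z • adjOp G hG) * (z • adjOp G hG + P₂) := by rw [← e1]
  rw [e4, e5]
  nth_rw 1 [e1]
  nth_rw 1 [e2]
  simp only [mul_add, mul_sub, sub_mul, smul_mul_assoc, mul_smul_comm, smul_smul,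
    one_mul, mul_one, smul_add, smul_sub]
  module

theorem one_sub_sq_smul_tsum_geomPathSum :
    (1 - (1 - t) ^ 2 * z ^ 2) • ∑' n : ℕ, z ^ (n + 1) • geomPathSum G hG t n =
      ((1 - t) ^ 2 * z ^ 2) • ∑' n : ℕ, z ^ (n + 1) • pathOp G hG t (n + 1) := by
  have hs1 := summable_pathOp G hG hdeg hM ht hz
  have hs := summable_geomPathSum G hG hdeg hM ht hz
  have e1 := hs.tsum_eq_zero_add
  have e2 := ((summable_nat_add_iff 1).2 hs).tsum_eq_zero_add
  have e3 : ∑' n : ℕ, z ^ (n + 1 + 1 + 1) • geomPathSum G hG t (n + 1 + 1) =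
      ((1 - t) ^ 2 * z ^ 2) • ((∑' n : ℕ, z ^ (n + 1) • pathOp G hG t (n + 1)) +
        ∑' n : ℕ, z ^ (n + 1) • geomPathSum G hG t n) := by
    rw [← hs1.tsum_add hs, ← (hs1.add hs).tsum_const_smul]
    refine tsum_congr fun n => ?_
    rw [geomPathSum_add_two]
    module
  simp only [zero_add, geomPathSum_zero, geomPathSum_one, smul_zero] at e1 e2
  rw [e3] at e2
  rw [e2] at e1
  rw [sub_smul, one_smul]
  nth_rw 1 [e1]
  module

end Sums

/-- Here R plays the role of (I - f)⁻¹, P and B those of the generating functions of C_m and of the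
geometric sums, and Q + (1-t) that of D. After P and B are expressed through R, everything is linear
in 1, Q, R, AR and QR, so commutativity of A and Q is not needed. -/
theorem main_generating_identity {E : Type*} [Ring E] [Algebra ℂ E] {t z : ℂ} (ht : 1 - t ≠ 0)
    (hw : 1 - (1 - t) ^ 2 * z ^ 2 ≠ 0) {A Q R P B : E}
    (hR : R = 1 + (z • A - (z ^ 2 * (1 - t)) • Q) * R)
    (hP : 1 + P = (1 - (1 - t) ^ 2 * z ^ 2) • R)
    (hB : (1 - (1 - t) ^ 2 * z ^ 2) • B = ((1 - t) ^ 2 * z ^ 2) • P) :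
    P - ((1 - t)⁻¹ • (Q - (1 - t) • (1 : E))) * B -
        ((1 - t) * t * z ^ 2 / (1 - (1 - t) ^ 2 * z ^ 2)) • (Q + (1 - t) • (1 : E)) =
      z • ((A - (2 * z * (1 - t)) • Q) * R) +
        ((1 - t) ^ 2 * z ^ 2 / (1 - (1 - t) ^ 2 * z ^ 2)) •
          (Q + (1 - t) • (1 : E) - (2 : ℂ) • (1 : E)) := by
  have hP' : P = (1 - (1 - t) ^ 2 * z ^ 2) • R - 1 := by rw [← hP, add_sub_cancel_left]
  have hB' : B = ((1 - t) ^ 2 * z ^ 2) • R -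
      ((1 - t) ^ 2 * z ^ 2 / (1 - (1 - t) ^ 2 * z ^ 2)) • (1 : E) := by
    rw [← inv_smul_smul₀ hw B, hB, hP']
    match_scalars <;> field_simp
  have hR' : R - 1 - (z • (A * R) - (z ^ 2 * (1 - t)) • (Q * R)) = 0 := by
    nth_rw 1 [hR]
    rw [sub_mul, smul_mul_assoc, smul_mul_assoc]
    abel
  -- The difference of the two sides is precisely the relation R - 1 - fR = 0.
  rw [hB', hP', ← sub_eq_zero, ← hR']
  simp only [mul_sub, sub_mul, smul_mul_assoc, mul_smul_comm, smul_smul, one_mul, mul_one,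
    smul_sub]
  match_scalars <;> field_simp <;> ring

end MainOperators

end BartholdiZeta

namespace BartholdiZeta

/-! ### Termwise differentiation of holomorphic series -/

section PowerSeries

theorem summable_div_mul_pow {c : ℕ → ℂ} {K a : ℝ} (ha0 : 0 ≤ a)
    (hc : ∀ n : ℕ, ‖c n‖ ≤ K * ((n + 1) * a ^ (n + 1))) {z : ℂ} (hz : ‖z‖ * a < 1) :
    Summable fun n : ℕ => c n / ((n : ℂ) + 1) * z ^ (n + 1) := by
  refine Summable.of_norm_bounded (summable_smul_of_norm_le ha0 hc hz).norm fun n => ?_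
  have h1 : (1 : ℝ) ≤ ‖(n : ℂ) + 1‖ := by
    rw [← Nat.cast_add_one, Complex.norm_natCast]
    simp
  rw [norm_mul, norm_div, norm_smul, mul_comm]
  exact mul_le_mul_of_nonneg_left (div_le_self (norm_nonneg _) h1) (norm_nonneg _)

theorem exists_between_norm {z : ℂ} {a : ℝ} (ha : 0 < a) (hz : ‖z‖ * a < 1) :
    ∃ r : ℝ, ‖z‖ < r ∧ r * a < 1 := by
  obtain ⟨r, h1, h2⟩ := exists_between ((lt_div_iff₀ ha).2 hz)
  exact ⟨r, h1, (lt_div_iff₀ ha).1 h2⟩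

/-- By Weierstrass, a majorant for the functions themselves suffices; none is needed for their
derivatives. -/
theorem hasDerivAt_tsum_of_norm_le {F F' : ℕ → ℂ → ℂ} {b : ℕ → ℝ} (hb : Summable b)
    {r : ℝ} (hF : ∀ n z, HasDerivAt (F n) (F' n z) z)
    (hle : ∀ n z, ‖z‖ < r → ‖F n z‖ ≤ b n) {z : ℂ} (hz : ‖z‖ < r) :
    HasDerivAt (fun w => ∑' n, F n w) (∑' n, F' n z) z ∧ Summable fun n => F' n z := by
  have hU : IsOpen (Metric.ball (0 : ℂ) r) := Metric.isOpen_ball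
  have hz' : z ∈ Metric.ball (0 : ℂ) r := by simpa using hz
  have hd : ∀ n, DifferentiableOn ℂ (F n) (Metric.ball 0 r) := fun n w _ =>
    (hF n w).differentiableAt.differentiableWithinAt
  have hle' : ∀ (n : ℕ) (w : ℂ), w ∈ Metric.ball (0 : ℂ) r → ‖F n w‖ ≤ b n := fun n w hw =>
    hle n w (by simpa using hw)
  have h1 := Complex.hasSum_deriv_of_summable_norm hb hd hU hle' hz'
  have h2 := (Complex.differentiableOn_tsum_of_summable_norm hb hd hU hle').differentiableAt
    (hU.mem_nhds hz')
  simp only [(hF _ z).deriv] at h1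
  exact ⟨h1.tsum_eq ▸ h2.hasDerivAt, h1.summable⟩

theorem hasDerivAt_tsum_div_mul_pow {c : ℕ → ℂ} {K a : ℝ} (ha : 0 < a)
    (hc : ∀ n : ℕ, ‖c n‖ ≤ K * ((n + 1) * a ^ (n + 1))) {z : ℂ} (hz : ‖z‖ * a < 1) :
    HasDerivAt (fun w : ℂ => ∑' n : ℕ, c n / ((n : ℂ) + 1) * w ^ (n + 1))
      (∑' n : ℕ, z ^ n * c n) z := by
  obtain ⟨r, hzr, hra⟩ := exists_between_norm ha hz
  have hr0 : 0 ≤ r := (norm_nonneg z).trans hzr.le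
  have hb := (summable_div_mul_pow ha.le hc (z := (r : ℂ))
    (by rwa [Complex.norm_of_nonneg hr0])).norm
  refine (hasDerivAt_tsum_of_norm_le (F' := fun n z => z ^ n * c n) hb (r := r) (fun n z => ?_)
    (fun n z hz => ?_) hzr).1
  · have h := (hasDerivAt_pow (n + 1) z).const_mul (c n / ((n : ℂ) + 1))
    have : (n : ℂ) + 1 ≠ 0 := Nat.cast_add_one_ne_zero n
    refine h.congr_deriv ?_
    rw [Nat.add_sub_cancel, Nat.cast_add_one, ← mul_assoc, div_mul_cancel₀ _ this, mul_comm]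
  · rw [norm_mul, norm_mul, norm_pow, norm_pow, Complex.norm_of_nonneg hr0]
    gcongr

end PowerSeries

/-! ### Commutators with powers -/

section Commutators

/-- For fixed i, the difference d fⁿ - f^{n-i} d f^i telescopes into the terms f^{n-j}(df -
fd)f^{j-1} with i < j ≤ n. Summed over 0 ≤ i ≤ n, the j-th term occurs once for each i < j, hence j
times. -/
theorem nsmul_mul_pow_sub_sum {R : Type*} [Ring R] (f d : R) (n : ℕ) :
    ((n + 1 : ℕ) : R) * (d * f ^ n) - ∑ i ∈ Finset.range (n + 1), f ^ (n - i) * d * f ^ i =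
      ∑ j ∈ Finset.Icc 1 n, (j : R) * (f ^ (n - j) * (d * f - f * d) * f ^ (j - 1)) := by
  induction n with
  | zero => simp
  | succ n ih =>
    have h1 : ∑ i ∈ Finset.range (n + 1), f ^ (n + 1 - i) * d * f ^ i =
        f * ∑ i ∈ Finset.range (n + 1), f ^ (n - i) * d * f ^ i := by
      rw [Finset.mul_sum]
      refine Finset.sum_congr rfl fun i hi => ?_
      rw [Nat.sub_add_comm (Nat.lt_succ_iff.1 (Finset.mem_range.1 hi)), pow_succ', mul_assoc,
        mul_assoc, mul_assoc]
    have h2 : ∑ j ∈ Finset.Icc 1 n, (j : R) * (f ^ (n + 1 - j) * (d * f - f * d) * f ^ (j - 1)) =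
        f * ∑ j ∈ Finset.Icc 1 n, (j : R) * (f ^ (n - j) * (d * f - f * d) * f ^ (j - 1)) := by
      rw [Finset.mul_sum]
      refine Finset.sum_congr rfl fun j hj => ?_
      rw [Nat.sub_add_comm (Finset.mem_Icc.1 hj).2, pow_succ', ← mul_assoc f (j : R),
        ← (Nat.cast_commute j f).eq, mul_assoc (j : R)]
      simp only [mul_assoc]
    rw [Finset.sum_range_succ, Finset.sum_Icc_succ_top (by omega), h1, h2, ← ih]
    simp only [Nat.sub_self, pow_zero, one_mul, Nat.add_sub_cancel, pow_succ' f n, Nat.cast_add,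
      Nat.cast_one]
    have h3 : (n : R) * f = f * n := (Nat.cast_commute n f).eq
    have h4 : f * ((n : R) * (d * f ^ n)) = (n : R) * (f * (d * f ^ n)) := by
      rw [← mul_assoc, ← h3, mul_assoc]
    simp only [mul_sub, sub_mul, add_mul, mul_add, one_mul, mul_assoc, h4]
    abel

end Commutators

/-! ### The derivative of the operator logarithm -/

section Logarithm

variable {V : Type*} [DecidableEq V] (G : SimpleGraph V) [G.LocallyFinite]

/-- The derivative of `z ↦ f(z)`. -/
noncomputable def fOpDeriv (hG : BoundedDegree G) (t z : ℂ) : L2 V →L[ℂ] L2 V :=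
  adjOp G hG - (2 * z * (1 - t)) • QT G hG t

theorem hasDerivAt_fOp (hG : BoundedDegree G) (t z : ℂ) :
    HasDerivAt (fOp G hG t) (fOpDeriv G hG t z) z := by
  have h1 := (hasDerivAt_id' z).smul_const (adjOp G hG)
  have h2 := ((hasDerivAt_pow 2 z).mul_const (1 - t)).smul_const (QT G hG t)
  have h3 := h1.sub h2
  rw [one_smul, Nat.add_one_sub_one, pow_one, Nat.cast_ofNat] at h3
  exact h3

theorem fOpDeriv_commutator (hG : BoundedDegree G) (t z : ℂ) :
    fOpDeriv G hG t z * fOp G hG t z - fOp G hG t z * fOpDeriv G hG t z =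
      ((1 - t) * z ^ 2) •
        (adjOp G hG * valencyOp G hG - valencyOp G hG * adjOp G hG) := by
  have hD : valencyOp G hG = QT G hG t + (1 - t) • (1 : L2 V →L[ℂ] L2 V) := by
    rw [QT, idT, sub_add_cancel]
  rw [hD, fOp, fOpDeriv]
  simp only [mul_add, mul_sub, add_mul, sub_mul, smul_mul_assoc, mul_smul_comm, one_mul,
    mul_one]
  module

theorem summable_add_one_mul_pow {q : ℝ} (hq0 : 0 ≤ q) (hq1 : q < 1) :
    Summable fun n : ℕ => ((n : ℝ) + 1) * q ^ n := by
  have h1 := summable_pow_mul_geometric_of_norm_lt_one 1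
    (by rwa [Real.norm_of_nonneg hq0] : ‖q‖ < 1)
  simp only [pow_one] at h1
  simpa only [add_mul, one_mul] using h1.add (summable_geometric_of_lt_one hq0 hq1)

/-- The series `∑_{n ≥ 1} [f(z)ⁿ](x₀, x) / n`. -/
noncomputable def logSeries (hG : BoundedDegree G) (t : ℂ) (x₀ x : V) (z : ℂ) : ℂ :=
  ∑' n : ℕ, ((n : ℂ) + 1)⁻¹ * entry (fOp G hG t z ^ (n + 1)) x₀ x

theorem norm_inv_natCast_add_one_le (n : ℕ) : ‖((n : ℂ) + 1)⁻¹‖ ≤ 1 := by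
  rw [norm_inv, ← Nat.cast_add_one, Complex.norm_natCast]
  exact inv_le_one_of_one_le₀ (by simp)

theorem entry_opLog (hG : BoundedDegree G) (t : ℂ) (x₀ x : V) {z : ℂ}
    (hf : ‖fOp G hG t z‖ < 1) :
    entry (opLog (1 - fOp G hG t z)) x₀ x = -logSeries G hG t x₀ x z := by
  have hs : Summable fun n : ℕ => ((n : ℂ) + 1)⁻¹ • fOp G hG t z ^ (n + 1) := by
    refine Summable.of_norm_bounded
      ((summable_nat_add_iff 1).2 (summable_geometric_of_lt_one (norm_nonneg _) hf)) fun n => ?_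
    rw [norm_smul]
    refine (mul_le_of_le_one_left (norm_nonneg _) (norm_inv_natCast_add_one_le n)).trans ?_
    exact norm_pow_le' _ n.succ_pos
  rw [opLog, ← entryCLM_apply, map_neg, sub_sub_cancel, (entryCLM x₀ x).map_tsum hs, logSeries]
  simp only [map_smul, smul_eq_mul, entryCLM_apply]

/-- There are n + 1 summands, each with j/(n+2) ≤ 1 and total power n of f. -/
theorem norm_commTerm_le (hG : BoundedDegree G) (t : ℂ) (x₀ x : V) (z : ℂ) (n : ℕ) :
    ‖commTerm G hG t z x₀ x (n + 2)‖ ≤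
      ‖adjOp G hG * valencyOp G hG - valencyOp G hG * adjOp G hG‖ *
        ((n + 1) * ‖fOp G hG t z‖ ^ n) := by
  set c := adjOp G hG * valencyOp G hG - valencyOp G hG * adjOp G hG with hc
  set f := fOp G hG t z
  have hpow : ∀ k : ℕ, ‖f ^ k‖ ≤ ‖f‖ ^ k := fun k => by
    rcases k with _ | k
    · rw [pow_zero, pow_zero]
      exact ContinuousLinearMap.norm_id_le
    · exact norm_pow_le' _ k.succ_pos
  rw [commTerm, ← hc, Finset.mul_sum]
  refine (norm_sum_le_of_le (f := fun j : ℕ => 1 / ((n + 2 : ℕ) : ℂ) * ((j : ℂ) *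
    entry (f ^ (n + 2 - 1 - j) * c * f ^ (j - 1)) x₀ x)) _
    (n := fun _ => ‖c‖ * ‖f‖ ^ n) fun j hj => ?_).trans ?_
  · rw [Finset.mem_Icc] at hj
    have h1 : ‖1 / ((n + 2 : ℕ) : ℂ)‖ * ‖(j : ℂ)‖ ≤ 1 := by
      rw [norm_div, norm_one, Complex.norm_natCast, Complex.norm_natCast, one_div_mul_eq_div]
      refine div_le_one_of_le₀ ?_ (Nat.cast_nonneg _)
      exact_mod_cast (by omega : j ≤ n + 2)
    have h2 : ‖entry (f ^ (n + 2 - 1 - j) * c * f ^ (j - 1)) x₀ x‖ ≤ ‖c‖ * ‖f‖ ^ n := by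
      refine (norm_entry_le _ _ _).trans ((norm_mul_le _ _).trans ?_)
      calc ‖f ^ (n + 2 - 1 - j) * c‖ * ‖f ^ (j - 1)‖
          ≤ (‖f‖ ^ (n + 2 - 1 - j) * ‖c‖) * ‖f‖ ^ (j - 1) := by
            gcongr
            · refine (norm_mul_le _ _).trans ?_
              gcongr
              exact hpow _
            · exact hpow _
        _ = ‖c‖ * ‖f‖ ^ (n + 2 - 1 - j + (j - 1)) := by
            rw [pow_add]
            ring
        _ = ‖c‖ * ‖f‖ ^ n := by
            congr 2
            omega
    rw [norm_mul, norm_mul, ← mul_assoc]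
    exact (mul_le_mul h1 h2 (norm_nonneg _) zero_le_one).trans_eq (one_mul _)
  · rw [Finset.sum_const, Nat.card_Icc, nsmul_eq_mul]
    refine le_of_eq ?_
    rw [show n + 2 - 1 + 1 - 1 = n + 1 by omega]
    push_cast
    ring

theorem differentiable_commTerm (hG : BoundedDegree G) (t : ℂ) (x₀ x : V) (n : ℕ) :
    Differentiable ℂ fun z => commTerm G hG t z x₀ x n := by
  have hf : Differentiable ℂ (fOp G hG t) := fun z => (hasDerivAt_fOp G hG t z).differentiableAt
  have hp : ∀ k : ℕ, Differentiable ℂ fun z => fOp G hG t z ^ k := fun k z =>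
    ((hasDerivAt_fOp G hG t z).fun_pow' k).differentiableAt
  unfold commTerm
  refine Differentiable.const_mul (Differentiable.fun_sum fun j _ => Differentiable.const_mul ?_ _) _
  exact (entryCLM x₀ x).differentiable.comp (((hp _).mul_const _).mul (hp _))

/-- This is the gap between the n-th terms of f'(I - f)⁻¹ and of the true derivative of ∑ fⁿ/n,
obtained from the telescoping identity with d = f'. -/
theorem commTerm_mul (hG : BoundedDegree G) (t : ℂ) (x₀ x : V) (z : ℂ) (n : ℕ) :
    (1 - t) * z ^ 2 * commTerm G hG t z x₀ x (n + 1) =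
      entry (fOpDeriv G hG t z * fOp G hG t z ^ n) x₀ x -
        ((n : ℂ) + 1)⁻¹ * entry (∑ i ∈ Finset.range (n + 1),
          fOp G hG t z ^ (n - i) * fOpDeriv G hG t z * fOp G hG t z ^ i) x₀ x := by
  have h := congrArg (entryCLM x₀ x)
    (nsmul_mul_pow_sub_sum (fOp G hG t z) (fOpDeriv G hG t z) n)
  simp only [← nsmul_eq_mul, map_sub, map_nsmul, fOpDeriv_commutator, mul_smul_comm,
    smul_mul_assoc] at h
  rw [map_sum (entryCLM x₀ x) _ (Finset.Icc 1 n)] at h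
  simp only [map_smul, map_nsmul, smul_eq_mul, entryCLM_apply] at h
  have hn : (n : ℂ) + 1 ≠ 0 := Nat.cast_add_one_ne_zero n
  have h' : entry (fOpDeriv G hG t z * fOp G hG t z ^ n) x₀ x -
        ((n : ℂ) + 1)⁻¹ * entry (∑ i ∈ Finset.range (n + 1),
          fOp G hG t z ^ (n - i) * fOpDeriv G hG t z * fOp G hG t z ^ i) x₀ x =
      ((n : ℂ) + 1)⁻¹ * (((n + 1 : ℕ) : ℂ) * entry (fOpDeriv G hG t z * fOp G hG t z ^ n) x₀ x -
        entry (∑ i ∈ Finset.range (n + 1),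
          fOp G hG t z ^ (n - i) * fOpDeriv G hG t z * fOp G hG t z ^ i) x₀ x) := by
    push_cast
    field_simp
  simp only [nsmul_eq_mul] at h
  rw [h', h, commTerm, Finset.mul_sum, Finset.mul_sum, Finset.mul_sum]
  refine Finset.sum_congr (by simp) fun j _ => ?_
  simp only [Nat.add_sub_cancel, one_div]
  push_cast
  ring

section Ball

variable (hG : BoundedDegree G) (hdeg : ∀ v, 1 ≤ G.degree v) (hM : 1 ≤ maxDeg G) {t : ℂ}
  (ht : ‖t‖ < 1)

include hM hdeg ht

/-- Uniform bounds q < 1 on a slightly larger disc supply the majorants for differentiating series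
in powers of f. -/
theorem exists_radius {z : ℂ} (hz : ‖z‖ < 1 / alpha G t) :
    ∃ r q : ℝ, ‖z‖ < r ∧ 0 ≤ q ∧ q < 1 ∧ ∀ w : ℂ, ‖w‖ < r → ‖fOp G hG t w‖ ≤ q := by
  obtain ⟨r, h1, h2⟩ := exists_between hz
  have hr0 : 0 ≤ r := (norm_nonneg z).trans h1.le
  refine ⟨r, r * maxDeg G + r ^ 2 * ((1 + ‖t‖) * maxDeg G), h1, by positivity,
    majorant_lt_one G hM t hr0 h2, fun w hw => ?_⟩
  refine (norm_fOp_le G hG hdeg ht w).trans ?_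
  gcongr

theorem norm_fOp_lt_one {z : ℂ} (hz : ‖z‖ < 1 / alpha G t) : ‖fOp G hG t z‖ < 1 := by
  obtain ⟨r, q, h1, _, h2, h3⟩ := exists_radius G hG hdeg hM ht hz
  exact (h3 z h1).trans_lt h2

theorem summable_commTerm (x₀ x : V) {z : ℂ} (hz : ‖z‖ < 1 / alpha G t) :
    Summable fun n : ℕ => commTerm G hG t z x₀ x (n + 2) := by
  have hf := norm_fOp_lt_one G hG hdeg hM ht hz
  refine Summable.of_norm_bounded ?_ (norm_commTerm_le G hG t x₀ x z)
  exact (summable_add_one_mul_pow (norm_nonneg _) hf).mul_left _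

theorem differentiableOn_commIntegrand (x₀ x : V) :
    DifferentiableOn ℂ (commIntegrand G hG t x₀ x) (Metric.ball 0 (1 / alpha G t)) := by
  intro z hz
  have hz' : ‖z‖ < 1 / alpha G t := by simpa using hz
  obtain ⟨r, q, h1, hq0, hq1, h3⟩ := exists_radius G hG hdeg hM ht hz'
  have hs := (summable_add_one_mul_pow hq0 hq1).mul_left
    ‖adjOp G hG * valencyOp G hG - valencyOp G hG * adjOp G hG‖
  have hd := (hasDerivAt_tsum_of_norm_le (F := fun n z => commTerm G hG t z x₀ x (n + 2)) hs
    (r := r) (fun n w => (differentiable_commTerm G hG t x₀ x (n + 2) w).hasDerivAt)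
    (fun n w hw => (norm_commTerm_le G hG t x₀ x w n).trans (by
      have := h3 w hw
      gcongr)) h1).1.differentiableAt
  have h2 : DifferentiableAt ℂ (fun z : ℂ => (1 - t) * z ^ 2) z := by fun_prop
  exact (h2.mul hd).differentiableWithinAt

theorem hasDerivAt_logSeries_tsum (x₀ x : V) {z : ℂ} (hz : ‖z‖ < 1 / alpha G t) :
    HasDerivAt (logSeries G hG t x₀ x)
      (∑' n : ℕ, ((n : ℂ) + 1)⁻¹ * entry (∑ i ∈ Finset.range (n + 1),
        fOp G hG t z ^ (n - i) * fOpDeriv G hG t z * fOp G hG t z ^ i) x₀ x) z ∧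
    Summable fun n : ℕ => ((n : ℂ) + 1)⁻¹ * entry (∑ i ∈ Finset.range (n + 1),
        fOp G hG t z ^ (n - i) * fOpDeriv G hG t z * fOp G hG t z ^ i) x₀ x := by
  obtain ⟨r, q, h1, hq0, hq1, h3⟩ := exists_radius G hG hdeg hM ht hz
  have hb : Summable fun n : ℕ => q ^ (n + 1) :=
    (summable_nat_add_iff 1).2 (summable_geometric_of_lt_one hq0 hq1)
  refine hasDerivAt_tsum_of_norm_le
    (F := fun n z => ((n : ℂ) + 1)⁻¹ * entry (fOp G hG t z ^ (n + 1)) x₀ x)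
    (F' := fun n z => ((n : ℂ) + 1)⁻¹ * entry (∑ i ∈ Finset.range (n + 1),
      fOp G hG t z ^ (n - i) * fOpDeriv G hG t z * fOp G hG t z ^ i) x₀ x)
    hb (fun n w => ?_) (fun n w hw => ?_) h1
  · have h := (hasDerivAt_fOp G hG t w).fun_pow' (n + 1)
    exact ((entryCLM x₀ x).hasFDerivAt.comp_hasDerivAt w h).const_mul _
  · rw [norm_mul]
    refine (mul_le_of_le_one_left (norm_nonneg _) (norm_inv_natCast_add_one_le n)).trans ?_
    refine (norm_entry_le _ _ _).trans ((norm_pow_le' _ n.succ_pos).trans ?_)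
    exact pow_le_pow_left₀ (norm_nonneg _) (h3 w hw) _

theorem hasSum_entry_mul_geometric (x₀ x : V) {z : ℂ} (hz : ‖z‖ < 1 / alpha G t)
    (T : L2 V →L[ℂ] L2 V) :
    HasSum (fun n : ℕ => entry (T * fOp G hG t z ^ n) x₀ x)
      (entry (T * ∑' n : ℕ, fOp G hG t z ^ n) x₀ x) := by
  have hgeo : Summable fun n : ℕ => fOp G hG t z ^ n :=
    summable_geometric_of_norm_lt_one (norm_fOp_lt_one G hG hdeg hM ht hz)
  exact (hgeo.hasSum.mul_left T).mapL (entryCLM x₀ x)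

theorem hasDerivAt_logSeries (x₀ x : V) {z : ℂ} (hz : ‖z‖ < 1 / alpha G t) :
    HasDerivAt (logSeries G hG t x₀ x)
      (entry (fOpDeriv G hG t z * ∑' n : ℕ, fOp G hG t z ^ n) x₀ x -
        commIntegrand G hG t x₀ x z) z := by
  obtain ⟨h1, h2⟩ := hasDerivAt_logSeries_tsum G hG hdeg hM ht x₀ x hz
  refine h1.congr_deriv ?_
  have h3 := hasSum_entry_mul_geometric G hG hdeg hM ht x₀ x hz (fOpDeriv G hG t z)
  have h4 : HasSum (fun n : ℕ => (1 - t) * z ^ 2 * commTerm G hG t z x₀ x (n + 1))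
      (commIntegrand G hG t x₀ x z) := by
    refine HasSum.mul_left _ ((hasSum_nat_add_iff' 1).1 ?_)
    -- The sum over j is empty for index 1, so starting at 1 or at 2 gives the same series.
    have h0 : commTerm G hG t z x₀ x 1 = 0 := by simp [commTerm]
    simpa only [Finset.sum_range_one, zero_add, h0, sub_zero, add_assoc, Nat.reduceAdd] using
      (summable_commTerm G hG hdeg hM ht x₀ x hz).hasSum
  have h5 := h3.sub h2.hasSum
  simp only [← commTerm_mul] at h5
  rw [h4.unique h5, sub_sub_cancel]

end Ball

end Logarithm

end BartholdiZeta

/-! ### Splitting the logarithm of zeta and integrating -/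

namespace BartholdiZeta

theorem ceil_half_sub_one (n : ℕ) : ⌈((n + 1 : ℕ) : ℚ) / 2⌉₊ - 1 = n / 2 := by
  suffices h : ⌈((n + 1 : ℕ) : ℚ) / 2⌉₊ = n / 2 + 1 by rw [h, Nat.add_sub_cancel]
  rw [Nat.ceil_eq_iff (by omega), Nat.add_sub_cancel]
  have h1 : ((2 * (n / 2) : ℕ) : ℚ) < ((n + 1 : ℕ) : ℚ) := by exact_mod_cast (by omega)
  have h2 : ((n + 1 : ℕ) : ℚ) ≤ ((2 * (n / 2) + 2 : ℕ) : ℚ) := by exact_mod_cast (by omega)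
  push_cast at *
  constructor <;> linarith

theorem one_sub_sq_mul_sq_mem_slitPlane {t z : ℂ} {a : ℝ} (ha : ‖1 - t‖ ≤ a)
    (hz : ‖z‖ * a < 1) :
    1 - (1 - t) ^ 2 * z ^ 2 ∈ Complex.slitPlane := by
  have h1 : ‖(1 - t) * z‖ < 1 := by
    rw [norm_mul, mul_comm]
    refine lt_of_le_of_lt ?_ hz
    gcongr
  have h2 : ‖(1 - t) ^ 2 * z ^ 2‖ < 1 := by
    rw [← mul_pow, norm_pow]
    exact pow_lt_one₀ (norm_nonneg _) h1 two_ne_zero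
  left
  rw [Complex.sub_re, Complex.one_re, sub_pos]
  exact (Complex.re_le_norm _).trans_lt h2

variable {V : Type*} [DecidableEq V] (G : SimpleGraph V) [G.LocallyFinite]

theorem cbcOp_one (hG : BoundedDegree G) (t : ℂ) : cbcOp G hG t 1 = mainOp G hG t 0 := by
  simp [cbcOp, mainOp, geomPathSum_zero, evenCoeff_zero]

/-- `mainOp` follows the general even-length pattern C_2 - (1-t)tD also at length two; the extra
term restores the convention t C_2 and produces the factor with tD - C_2. -/
theorem cbcOp_two (hG : BoundedDegree G) (t : ℂ) :
    cbcOp G hG t 2 = mainOp G hG t 1 + (1 - t) • (t • valencyOp G hG - pathOp G hG t 2) := by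
  simp only [cbcOp, mainOp, geomPathSum_one, evenCoeff_one, mul_zero, sub_zero, Nat.reduceAdd,
    show ¬(2 ≤ 1) by omega, if_false, if_true]
  module

theorem cbcOp_add_three (hG : BoundedDegree G) (t : ℂ) (n : ℕ) :
    cbcOp G hG t (n + 3) = mainOp G hG t (n + 2) + (1 - t) • Rop G hG t (n + 3) := by
  rw [cbcOp, if_neg (by omega), if_neg (by omega), ceil_half_sub_one (n + 2), mainOp,
    geomPathSum, evenCoeff, show n + 3 - 1 = n + 2 by omega]
  abel

theorem entry_one (x₀ x : V) :
    entry (1 : L2 V →L[ℂ] L2 V) x₀ x = if x₀ = x then 1 else 0 := by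
  change (lp.single (E := fun _ : V => ℂ) 2 x₀ (1 : ℂ) : L2 V) x = _
  by_cases hx : x₀ = x
  · subst hx
    simp
  · simp [hx, Ne.symm hx]

theorem entry_Rop (hG : BoundedDegree G) (t : ℂ) (m : ℕ) (x₀ x : V) :
    entry (Rop G hG t m) x₀ x = if x₀ = x then Rfun G hG t m x₀ else 0 :=
  entry_diagOp _ _ _ _

section Ball

variable (hG : BoundedDegree G) (hdeg : ∀ v, 1 ≤ G.degree v) (hM : 1 ≤ maxDeg G) {t : ℂ}
  (ht : ‖t‖ < 1)

include hdeg ht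

theorem norm_laplacianDiag_le (m : ℕ) (x : V) :
    ‖laplacianDiag G hG t m x‖ ≤ 2 * maxDeg G * alpha G t ^ m := by
  have hx : (G.degree x : ℝ) ≤ maxDeg G := by exact_mod_cast degree_le_maxDeg G hG x
  have hC : ∀ y, ‖entry (pathOp G hG t m) y y‖ ≤ alpha G t ^ m := fun y =>
    (norm_entry_le _ y y).trans (norm_pathOp_le G hG hdeg ht m)
  have h0 : 0 ≤ alpha G t ^ m := (norm_nonneg _).trans (hC x)
  have h : 2 * maxDeg G * alpha G t ^ m =
      maxDeg G * alpha G t ^ m + maxDeg G * alpha G t ^ m := by ring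
  rw [h]
  refine (norm_sub_le _ _).trans (add_le_add ?_ ?_)
  · rw [norm_mul, Complex.norm_natCast]
    exact mul_le_mul hx (hC x) (norm_nonneg _) (Nat.cast_nonneg _)
  · refine (norm_sum_le _ _).trans ((Finset.sum_le_card_nsmul _ _ _ fun y _ => hC y).trans ?_)
    rw [nsmul_eq_mul, SimpleGraph.card_neighborFinset_eq_degree]
    exact mul_le_mul_of_nonneg_right hx h0

include hM

/-- Each summand has total exponent 2(j-i) + 2(i-1) + (n+1-2j) = n - 1 in α, since |1-t| ≤ α and
|1-t²| ≤ α². The two factors n + 1 bound the number of pairs (j, i); one of them is absorbed by the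
division by m in `summable_Rop`. -/
theorem norm_Rfun_le (n : ℕ) (x : V) :
    ‖Rfun G hG t (n + 1) x‖ ≤
      2 * maxDeg G * ((n + 1) * ((n + 1) * alpha G t ^ (n + 1))) := by
  have ha1 := one_le_alpha hM t
  have ha0 : 0 ≤ alpha G t := zero_le_one.trans ha1
  have ha := (norm_one_sub_lt_alpha hM ht).le
  have ha2 := norm_one_sub_sq_le_alpha_sq hM ht
  set b : ℝ := 2 * maxDeg G * alpha G t ^ (n + 1) with hb
  have hb0 : 0 ≤ b := by positivity
  have hn : (n / 2 : ℕ) ≤ (n + 1 : ℝ) := by exact_mod_cast (by omega : n / 2 ≤ n + 1)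
  rw [Rfun, ceil_half_sub_one]
  have key : ∀ j ∈ Finset.Icc 1 (n / 2), ∀ i ∈ Finset.Icc 1 j,
      ‖(1 - t) ^ (2 * (j - i)) * (1 - t ^ 2) ^ (i - 1) *
        laplacianDiag G hG t (n + 1 - 2 * j) x‖ ≤ b := by
    intro j hj i hi
    rw [Finset.mem_Icc] at hj hi
    rw [norm_mul, norm_mul, norm_pow, norm_pow]
    calc ‖1 - t‖ ^ (2 * (j - i)) * ‖1 - t ^ 2‖ ^ (i - 1) *
          ‖laplacianDiag G hG t (n + 1 - 2 * j) x‖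
        ≤ alpha G t ^ (2 * (j - i)) * (alpha G t ^ 2) ^ (i - 1) *
          (2 * maxDeg G * alpha G t ^ (n + 1 - 2 * j)) := by
          gcongr
          exact norm_laplacianDiag_le G hG hdeg ht _ x
      _ = 2 * maxDeg G * alpha G t ^ (2 * (j - i) + 2 * (i - 1) + (n + 1 - 2 * j)) := by
          rw [← pow_mul, pow_add, pow_add]
          ring
      _ ≤ b := by
          exact mul_le_mul_of_nonneg_left (pow_le_pow_right₀ ha1 (by omega)) (by positivity)
  calc ‖∑ j ∈ Finset.Icc 1 (n / 2), ∑ i ∈ Finset.Icc 1 j, (1 - t) ^ (2 * (j - i)) *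
        (1 - t ^ 2) ^ (i - 1) * laplacianDiag G hG t (n + 1 - 2 * j) x‖
      ≤ ∑ j ∈ Finset.Icc 1 (n / 2), ∑ _i ∈ Finset.Icc 1 j, b :=
        norm_sum_le_of_le _ fun j hj => norm_sum_le_of_le _ (key j hj)
    _ ≤ ∑ j ∈ Finset.Icc 1 (n / 2), (n + 1 : ℝ) * b := by
        refine Finset.sum_le_sum fun j hj => ?_
        rw [Finset.mem_Icc] at hj
        rw [Finset.sum_const, Nat.card_Icc, nsmul_eq_mul]
        refine mul_le_mul_of_nonneg_right ?_ hb0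
        exact_mod_cast (by omega : j + 1 - 1 ≤ n + 1)
    _ ≤ (n + 1 : ℝ) * ((n + 1 : ℝ) * b) := by
        rw [Finset.sum_const, Nat.card_Icc, nsmul_eq_mul, Nat.add_sub_cancel]
        gcongr
    _ = _ := by
        rw [hb]
        ring

theorem summable_Rop (x₀ x : V) {u : ℂ} (hu : ‖u‖ * alpha G t < 1) :
    Summable fun m : ℕ => (1 - t) * entry (Rop G hG t (m + 3)) x₀ x / ((m : ℂ) + 3)
      * u ^ (m + 3) := by
  have ha0 : 0 ≤ alpha G t := zero_le_one.trans (one_le_alpha hM t)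
  have hs : Summable fun n : ℕ =>
      u ^ (n + 1) • ((1 - t) * entry (Rop G hG t (n + 1)) x₀ x / ((n : ℂ) + 1)) := by
    refine summable_smul_of_norm_le (K := ‖1 - t‖ * (2 * maxDeg G)) ha0 (fun n => ?_) hu
    have hn : (0 : ℝ) < n + 1 := by positivity
    have h1 : ‖entry (Rop G hG t (n + 1)) x₀ x‖ ≤
        2 * maxDeg G * ((n + 1) * ((n + 1) * alpha G t ^ (n + 1))) := by
      rw [entry_Rop]
      split_ifs
      · exact norm_Rfun_le G hG hdeg hM ht n x₀
      · rw [norm_zero]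
        positivity
    rw [norm_div, norm_mul, ← Nat.cast_add_one, Complex.norm_natCast, Nat.cast_add_one,
      div_le_iff₀ hn]
    calc ‖1 - t‖ * ‖entry (Rop G hG t (n + 1)) x₀ x‖
        ≤ ‖1 - t‖ * (2 * maxDeg G * ((n + 1) * ((n + 1) * alpha G t ^ (n + 1)))) := by gcongr
      _ = _ := by ring
  refine ((summable_nat_add_iff 2).2 hs).congr fun m => ?_
  rw [smul_eq_mul, mul_comm]
  push_cast
  ring_nf

theorem hasSum_mainOp {z : ℂ} (hz : ‖z‖ * alpha G t < 1) :
    HasSum (fun n : ℕ => z ^ (n + 1) • mainOp G hG t n)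
      (z • (fOpDeriv G hG t z * ∑' n : ℕ, fOp G hG t z ^ n) +
        ((1 - t) ^ 2 * z ^ 2 / (1 - (1 - t) ^ 2 * z ^ 2)) •
          (valencyOp G hG - (2 : ℂ) • (1 : L2 V →L[ℂ] L2 V))) := by
  have ha1 := one_le_alpha hM t
  have ha := norm_one_sub_lt_alpha hM ht
  have hf : ‖fOp G hG t z‖ < 1 := norm_fOp_lt_one G hG hdeg hM ht
    ((lt_div_iff₀ (one_pos.trans_le ha1)).2 hz)
  have hw : 1 - (1 - t) ^ 2 * z ^ 2 ≠ 0 :=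
    Complex.slitPlane_ne_zero (one_sub_sq_mul_sq_mem_slitPlane ha.le hz)
  have ht' : 1 - t ≠ 0 := sub_ne_zero.2 fun h => by simp [← h] at ht
  have hD : valencyOp G hG = QT G hG t + (1 - t) • (1 : L2 V →L[ℂ] L2 V) := by
    rw [QT, idT, sub_add_cancel]
  have hs1 := summable_pathOp G hG hdeg hM ht hz
  have hs2 := summable_geomPathSum G hG hdeg hM ht hz
  have hs3 := (hasSum_evenCoeff ht ha1 ha.le hz hw).smul_const (valencyOp G hG)
  have hsum := (hs1.hasSum.sub
    (hs2.hasSum.mul_left ((1 - t)⁻¹ • (QT G hG t - idT V t)))).sub hs3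
  have hR : ∑' n : ℕ, fOp G hG t z ^ n = 1 + fOp G hG t z * ∑' n : ℕ, fOp G hG t z ^ n := by
    have h := mul_neg_geom_series (fOp G hG t z) hf
    rw [sub_mul, one_mul] at h
    rw [← h, sub_add_cancel]
  -- The factor I - f is removed by multiplying from the left with its Neumann series.
  have hP : 1 + ∑' n : ℕ, z ^ (n + 1) • pathOp G hG t (n + 1) =
      (1 - (1 - t) ^ 2 * z ^ 2) • ∑' n : ℕ, fOp G hG t z ^ n := by
    have h := congrArg (fun T => (∑' n : ℕ, fOp G hG t z ^ n) * T)
      (one_sub_fOp_mul_tsum_pathOp G hG hdeg hM ht hz)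
    simp only [← mul_assoc, mul_smul_comm, mul_one] at h
    rwa [geom_series_mul_neg _ hf, one_mul] at h
  have hid := main_generating_identity ht' hw (A := adjOp G hG) (Q := QT G hG t) hR hP
    (one_sub_sq_smul_tsum_geomPathSum G hG hdeg hM ht hz)
  rw [← hD] at hid
  rw [idT, hid] at hsum
  rw [fOpDeriv]
  refine hsum.congr_fun fun n => ?_
  rw [mainOp, idT, smul_sub, smul_sub, mul_smul_comm, smul_smul]

theorem exists_norm_entry_mainOp_le (x₀ x : V) :
    ∃ K : ℝ, ∀ n : ℕ, ‖entry (mainOp G hG t n) x₀ x‖ ≤ K * ((n + 1) * alpha G t ^ (n + 1)) := by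
  obtain ⟨K, _, hK⟩ := exists_norm_mainOp_le G hG hdeg hM ht
  exact ⟨K, fun n => (norm_entry_le _ _ _).trans (hK n)⟩

theorem summable_mainOp_div (x₀ x : V) {u : ℂ} (hu : ‖u‖ * alpha G t < 1) :
    Summable fun n : ℕ => entry (mainOp G hG t n) x₀ x / ((n : ℂ) + 1) * u ^ (n + 1) := by
  obtain ⟨K, hK⟩ := exists_norm_entry_mainOp_le G hG hdeg hM ht x₀ x
  exact summable_div_mul_pow (zero_le_one.trans (one_le_alpha hM t)) hK hu

theorem hasDerivAt_mainSeries (x₀ x : V) {z : ℂ} (hz : ‖z‖ * alpha G t < 1) :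
    HasDerivAt
      (fun w : ℂ => ∑' n : ℕ, entry (mainOp G hG t n) x₀ x / ((n : ℂ) + 1) * w ^ (n + 1))
      (∑' n : ℕ, z ^ n * entry (mainOp G hG t n) x₀ x) z := by
  obtain ⟨K, hK⟩ := exists_norm_entry_mainOp_le G hG hdeg hM ht x₀ x
  exact hasDerivAt_tsum_div_mul_pow (one_pos.trans_le (one_le_alpha hM t)) hK hz

theorem tsum_pow_mul_entry_mainOp (x₀ x : V) {z : ℂ} (hz0 : z ≠ 0) (hz : ‖z‖ * alpha G t < 1) :
    ∑' n : ℕ, z ^ n * entry (mainOp G hG t n) x₀ x =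
      entry (fOpDeriv G hG t z * ∑' n : ℕ, fOp G hG t z ^ n) x₀ x +
        (1 - t) ^ 2 * z / (1 - (1 - t) ^ 2 * z ^ 2) *
          (((G.degree x₀ : ℂ) - 2) * if x₀ = x then 1 else 0) := by
  have h := ((hasSum_mainOp G hG hdeg hM ht hz).mapL (entryCLM x₀ x)).mul_left z⁻¹
  have hD : entryCLM x₀ x (valencyOp G hG - (2 : ℂ) • (1 : L2 V →L[ℂ] L2 V)) =
      ((G.degree x₀ : ℂ) - 2) * if x₀ = x then 1 else 0 := by
    rw [map_sub, map_smul, entryCLM_apply, entryCLM_apply, valencyOp, entry_diagOp, entry_one]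
    split_ifs <;> simp
  rw [map_add, map_smul, map_smul, hD] at h
  convert h.tsum_eq using 1
  · refine tsum_congr fun n => ?_
    rw [map_smul, entryCLM_apply, smul_eq_mul, pow_succ']
    field_simp
  · rw [entryCLM_apply, smul_eq_mul, smul_eq_mul]
    field_simp

theorem mainSeries_eq (x₀ x : V) {u : ℂ} (hu : ‖u‖ * alpha G t < 1) :
    ∑' n : ℕ, entry (mainOp G hG t n) x₀ x / ((n : ℂ) + 1) * u ^ (n + 1) =
      Complex.log (1 - (1 - t) ^ 2 * u ^ 2) *
          (-(((G.degree x₀ : ℂ) - 2) / 2) * (if x₀ = x then (1 : ℂ) else 0)) +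
        logSeries G hG t x₀ x u + segmentIntegral (commIntegrand G hG t x₀ x) u := by
  have ha0 : 0 < alpha G t := one_pos.trans_le (one_le_alpha hM t)
  set κ : ℂ := ((G.degree x₀ : ℂ) - 2) * (if x₀ = x then (1 : ℂ) else 0) with hκ
  -- The logarithm is weighted so that its derivative cancels the deg(x₀) - 2 term, leaving only the
  -- commutator integrand as derivative of Φ.
  set Φ : ℂ → ℂ := fun z =>
    (∑' n : ℕ, entry (mainOp G hG t n) x₀ x / ((n : ℂ) + 1) * z ^ (n + 1)) -
      logSeries G hG t x₀ x z + κ / 2 * Complex.log (1 - (1 - t) ^ 2 * z ^ 2) with hΦ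
  have hΦ0 : Φ 0 = 0 := by
    have h : ∀ n : ℕ, entry (fOp G hG t 0 ^ (n + 1)) x₀ x = 0 := fun n => by
      rw [← entryCLM_apply]
      simp [fOp]
    simp [hΦ, logSeries, h]
  have hderiv : ∀ z : ℂ, ‖z‖ * alpha G t < 1 → DifferentiableAt ℂ Φ z ∧
      (z ≠ 0 → HasDerivAt Φ (commIntegrand G hG t x₀ x z) z) := by
    intro z hz
    have hw := one_sub_sq_mul_sq_mem_slitPlane (norm_one_sub_lt_alpha hM ht).le hz
    have h1 := hasDerivAt_mainSeries G hG hdeg hM ht x₀ x hz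
    have h2 := hasDerivAt_logSeries G hG hdeg hM ht x₀ x ((lt_div_iff₀ ha0).2 hz)
    have h3 := ((((hasDerivAt_pow 2 z).const_mul ((1 - t) ^ 2)).const_sub 1).clog hw).const_mul
      (κ / 2)
    have h4 := (h1.sub h2).add h3
    refine ⟨h4.differentiableAt, fun hz0 => h4.congr_deriv ?_⟩
    rw [tsum_pow_mul_entry_mainOp G hG hdeg hM ht x₀ x hz0 hz]
    push_cast
    ring
  have hseg : ∀ s ∈ Set.Icc (0 : ℝ) 1, ‖(s : ℂ) * u‖ * alpha G t < 1 := by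
    intro s hs
    refine lt_of_le_of_lt ?_ hu
    rw [norm_mul, Complex.norm_of_nonneg hs.1]
    have := mul_le_of_le_one_left (norm_nonneg u) hs.2
    gcongr
  have hΦu : segmentIntegral (commIntegrand G hG t x₀ x) u = Φ u := by
    rcases eq_or_ne u 0 with rfl | hu0
    · rw [hΦ0, segmentIntegral, zero_mul]
    have hlin : ∀ s : ℝ, HasDerivAt (fun s : ℂ => s * u) u (s : ℂ) := fun s => by
      simpa using (hasDerivAt_id (s : ℂ)).mul_const u
    have hline : ∀ (s : ℝ) (D : ℂ), HasDerivAt Φ D ((s : ℂ) * u) →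
        HasDerivAt (fun s : ℝ => Φ ((s : ℂ) * u)) (D * u) s := fun s D h =>
      (HasDerivAt.comp (h₂ := Φ) (s : ℂ) h (hlin s)).comp_ofReal
    have hcont : ContinuousOn (fun s : ℝ => commIntegrand G hG t x₀ x ((s : ℂ) * u) * u)
        (Set.uIcc 0 1) := by
      rw [Set.uIcc_of_le zero_le_one]
      refine ContinuousOn.mul ?_ continuousOn_const
      refine (differentiableOn_commIntegrand G hG hdeg hM ht x₀ x).continuousOn.comp
        (by fun_prop) fun s hs => ?_
      simpa using (lt_div_iff₀ ha0).2 (hseg s hs)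
    -- The formula for the derivative came from a division by z and is available only for z ≠ 0;
    -- this form of the fundamental theorem asks only for continuity at the end points.
    have hFTC := intervalIntegral.integral_eq_sub_of_hasDerivAt_of_le
      (f := fun s : ℝ => Φ ((s : ℂ) * u)) zero_le_one
      (fun s hs => (hline s _
        (hderiv _ (hseg s hs)).1.hasDerivAt).continuousAt.continuousWithinAt)
      (fun s hs => hline s _ ((hderiv _ (hseg s ⟨hs.1.le, hs.2.le⟩)).2
        (mul_ne_zero (Complex.ofReal_ne_zero.2 hs.1.ne') hu0)))
      hcont.intervalIntegrable
    rw [intervalIntegral.integral_mul_const] at hFTC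
    rw [segmentIntegral, mul_comm, hFTC]
    simp [hΦ0]
  rw [hΦu, hΦ, hκ]
  ring

/-- The logarithm of the zeta function, split into the main series and the two correction
terms. -/
theorem hasSum_cbcOp (x₀ x : V) {u : ℂ} (hu : ‖u‖ * alpha G t < 1) :
    HasSum (fun m : ℕ => entry (cbcOp G hG t (m + 1)) x₀ x / ((m : ℂ) + 1) * u ^ (m + 1))
      (∑' n : ℕ, entry (mainOp G hG t n) x₀ x / ((n : ℂ) + 1) * u ^ (n + 1) +
        entry (t • valencyOp G hG - pathOp G hG t 2) x₀ x / 2 * ((1 - t) * u ^ 2) +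
        ∑' m : ℕ, (1 - t) * entry (Rop G hG t (m + 3)) x₀ x / ((m : ℂ) + 3) * u ^ (m + 3)) := by
  set X := entry (t • valencyOp G hG - pathOp G hG t 2) x₀ x / 2 * ((1 - t) * u ^ 2) with hX
  have h1 := (summable_mainOp_div G hG hdeg hM ht x₀ x hu).hasSum
  have h2 : HasSum (fun n : ℕ => if n = 1 then X else 0) X := hasSum_ite_eq 1 X
  have h3 : HasSum (fun n : ℕ => if n < 2 then 0 else
      (1 - t) * entry (Rop G hG t (n + 1)) x₀ x / ((n : ℂ) + 1) * u ^ (n + 1))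
      (∑' m : ℕ, (1 - t) * entry (Rop G hG t (m + 3)) x₀ x / ((m : ℂ) + 3) * u ^ (m + 3)) := by
    -- Index n stands for length n + 1, so the R-terms, which begin at length 3, begin at n = 2.
    rw [← hasSum_nat_add_iff' 2]
    rw [Finset.sum_eq_zero fun i hi => if_pos (Finset.mem_range.1 hi), sub_zero]
    refine (summable_Rop G hG hdeg hM ht x₀ x hu).hasSum.congr_fun fun m => ?_
    rw [if_neg (by omega)]
    push_cast
    ring_nf
  refine ((h1.add h2).add h3).congr_fun fun n => ?_
  match n with
  | 0 => simp [cbcOp_one]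
  | 1 =>
    rw [cbcOp_two, ← entryCLM_apply, map_add, map_smul, entryCLM_apply, entryCLM_apply,
      smul_eq_mul, hX]
    norm_num
    ring
  | n + 2 =>
    rw [cbcOp_add_three, ← entryCLM_apply, map_add, map_smul, entryCLM_apply, entryCLM_apply,
      smul_eq_mul, if_neg (by omega), if_neg (by omega)]
    ring

end Ball

end BartholdiZeta

/-- Bartholdi type formula for the generalized zeta function of a connected countable simple graph
of bounded degree with at least two vertices. The first four conjuncts say that the series and the
integral in the formula are meaningful. -/
theorem theorem4p4 {V : Type*} [DecidableEq V] [Countable V] [Nontrivial V]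
    (G : SimpleGraph V) [G.LocallyFinite] (hconn : G.Connected)
    (hG : BartholdiZeta.BoundedDegree G) (t u : ℂ) (ht : ‖t‖ < 1)
    (hu : ‖u‖ < 1 / BartholdiZeta.alpha G t) (x₀ x : V) :
    -- the series defining the zeta function converges
    Summable (fun m : ℕ =>
      BartholdiZeta.entry (BartholdiZeta.cbcOp G hG t (m + 1)) x₀ x / ((m : ℂ) + 1) * u ^ (m + 1)) ∧
    -- the operator whose logarithm is taken lies in the open unit ball around the identity
    ‖1 - (1 - u • (BartholdiZeta.valencyOp G hG - BartholdiZeta.laplacianOp G hG)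
        + ((1 - t) * u ^ 2) • BartholdiZeta.QT G hG t)‖ < 1 ∧
    -- the integrand is given by a convergent series and is holomorphic on the disc
    ((∀ z : ℂ, ‖z‖ < 1 / BartholdiZeta.alpha G t →
        Summable (fun n : ℕ => BartholdiZeta.commTerm G hG t z x₀ x (n + 2))) ∧
      DifferentiableOn ℂ (BartholdiZeta.commIntegrand G hG t x₀ x)
        (Metric.ball 0 (1 / BartholdiZeta.alpha G t))) ∧
    -- the series of the correction terms converges
    Summable (fun m : ℕ =>
      (1 - t) * BartholdiZeta.entry (BartholdiZeta.Rop G hG t (m + 3)) x₀ x / ((m : ℂ) + 3)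
        * u ^ (m + 3)) ∧
    -- the formula
    BartholdiZeta.zeta G hG u t x₀ x =
      (1 - (1 - t) ^ 2 * u ^ 2) ^
          (-(((G.degree x₀ : ℂ) - 2) / 2) * (if x₀ = x then (1 : ℂ) else 0))
        * Complex.exp (-BartholdiZeta.entry (BartholdiZeta.opLog
            (1 - u • (BartholdiZeta.valencyOp G hG - BartholdiZeta.laplacianOp G hG)
              + ((1 - t) * u ^ 2) • BartholdiZeta.QT G hG t)) x₀ x)
        * Complex.exp (BartholdiZeta.segmentIntegral
            (BartholdiZeta.commIntegrand G hG t x₀ x) u)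
        * Complex.exp (BartholdiZeta.entry
            (t • BartholdiZeta.valencyOp G hG - BartholdiZeta.pathOp G hG t 2) x₀ x / 2
              * ((1 - t) * u ^ 2))
        * Complex.exp (∑' m : ℕ,
            (1 - t) * BartholdiZeta.entry (BartholdiZeta.Rop G hG t (m + 3)) x₀ x / ((m : ℂ) + 3)
              * u ^ (m + 3)) := by
  have hdeg := BartholdiZeta.one_le_degree G hconn
  have hM := BartholdiZeta.one_le_maxDeg G hconn hG
  have ha0 : 0 < BartholdiZeta.alpha G t := one_pos.trans_le (BartholdiZeta.one_le_alpha hM t)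
  have hu' : ‖u‖ * BartholdiZeta.alpha G t < 1 := (lt_div_iff₀ ha0).1 hu
  have hf := BartholdiZeta.norm_fOp_lt_one G hG hdeg hM ht hu
  have hT : 1 - u • (BartholdiZeta.valencyOp G hG - BartholdiZeta.laplacianOp G hG)
      + ((1 - t) * u ^ 2) • BartholdiZeta.QT G hG t = 1 - BartholdiZeta.fOp G hG t u := by
    rw [BartholdiZeta.laplacianOp, sub_sub_cancel, BartholdiZeta.fOp, mul_comm (1 - t), sub_sub_eq_add_sub,
      sub_add_eq_add_sub]
  have hsum := BartholdiZeta.hasSum_cbcOp G hG hdeg hM ht x₀ x hu'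
  refine ⟨hsum.summable, ?_, ⟨fun z hz => BartholdiZeta.summable_commTerm G hG hdeg hM ht x₀ x hz,
    BartholdiZeta.differentiableOn_commIntegrand G hG hdeg hM ht x₀ x⟩,
    BartholdiZeta.summable_Rop G hG hdeg hM ht x₀ x hu', ?_⟩
  · rwa [hT, sub_sub_cancel]
  · have hw : 1 - (1 - t) ^ 2 * u ^ 2 ≠ 0 := Complex.slitPlane_ne_zero
      (BartholdiZeta.one_sub_sq_mul_sq_mem_slitPlane
        (BartholdiZeta.norm_one_sub_lt_alpha hM ht).le hu')
    rw [BartholdiZeta.zeta, hsum.tsum_eq, BartholdiZeta.mainSeries_eq G hG hdeg hM ht x₀ x hu',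
      hT, BartholdiZeta.entry_opLog G hG t x₀ x hf, neg_neg, Complex.cpow_def_of_ne_zero hw]
    simp only [Complex.exp_add]
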